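/- Let $\mathsf{M}$ be a cofibrantly generated monoidal model category: a symmetric monoidal closed category $(\mathsf{M},\otimes,\mathbb{1})$ with a model structure for which there are sets $I$ of cofibrations and $J$ of trivial cofibrations that permit the small object argument, such that the fibrations (resp. trivial fibrations) are exactly the maps with the right lifting property with respect to $J$ (resp. $I$), and which satisfies the pushout product axiom: for cofibrations $f: X_0\to X_1$ and $g: Y_0\to Y_1$ the pushout product $$f\mathbin\square g: (X_1\otimes Y_0)\coprod_{X_0\otimes Y_0}(X_0\otimes Y_1)\to X_1\otimes Y_1$$ is a cofibration, which is moreover a weak equivalence if $f$ or $g$ is one. For a symmetric monoidal model category $\mathsf{C}$ and $n\ge 1$, let $\mathsf{C}^{\Sigma_n}$ and $\mathsf{C}^{\Sigma_n^{op}}$ be the categories of objects of $\mathsf{C}$ with a left, respectively right, action of the symmetric group $\Sigma_n$. For $X\in\mathsf{C}^{\Sigma_n^{op}}$ and $Y\in \mathsf{C}^{\Sigma_n}$, $X\otimes_{\Sigma_n}Y$ denotes the $\Sigma_n$-coinvariants of $X\otimes Y$ with the diagonal action; for maps $f$ in $\mathsf{C}^{\Sigma_n^{op}}$ and $g$ in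 $\mathsf{C}^{\Sigma_n}$, $f\mathbin\square_{\Sigma_n} g$ denotes the map induced on $\Sigma_n$-coinvariants by the pushout product $f\mathbin\square g$ with the diagonal action. "Underlying" means after forgetting the action. For a map $f:V\to W$ in $\mathsf{C}$, $f^{\square n}$ denotes the $n$-fold iterated pushout product $f\mathbin\square\cdots\mathbin\square f$, a map in $\mathsf{C}^{\Sigma_n}$ by permutation of the factors. Consider the conditions: * $(\heartsuit)$ For each $n\ge 1$, each map $f$ in $\mathsf{C}^{\Sigma_n^{op}}$ that is an underlying cofibration between underlying cofibrant objects, and each map $g$ in $\mathsf{C}^{\Sigma_n}$ that is an underlying cofibration, the map $f\mathbin\square_{\Sigma_n} g$ is a cofibration in $\mathsf{C}$. * $(\clubsuit)_{cof}$ For each $n\ge 1$, each underlying cofibrant $X\in\mathsf{C}^{\Sigma_n^{op}}$ and each cofibration $f$ in $\mathsf{C}$, the map $X\otimes_{\Sigma_n} f^{\square n}$ is a cofibration in $\mathsf{C}$. Let $\overrightarrow{\mathsf{M}}{}^{\square}_{proj}$ be the category of maps of $\mathsf{M}$ and commutative squares, with the symmetric monoidal closed structure whose product is the pushout product $\square$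 and whose unit is $\varnothing\to\mathbb{1}$, and with the projective model structure: a map $\alpha: f_V\to f_W$ from $f_V:V_0\to V_1$ to $f_W:W_0\to W_1$ is a weak equivalence (resp. fibration) if and only if $\alpha_0:V_0\to W_0$ and $\alpha_1:V_1\to W_1$ are so in $\mathsf{M}$, and it is a cofibration if and only if $\alpha_0$ and the pushout corner map $V_1\coprod_{V_0}W_0\to W_1$ are cofibrations in $\mathsf{M}$. **Theorem.** If $\mathsf{M}$ is a cofibrantly generated monoidal model category satisfying $(\heartsuit)$, then $\overrightarrow{\mathsf{M}}{}^{\square}_{proj}$ satisfies $(\clubsuit)_{cof}$. That is, for each $n\ge 1$, each $f_X\in(\overrightarrow{\mathsf{M}}{}^{\square}_{proj})^{\Sigma_n^{op}}$ that is underlying cofibrant in $\overrightarrow{\mathsf{M}}{}^{\square}_{proj}$ and each cofibration $\alpha$ of $\overrightarrow{\mathsf{M}}{}^{\square}_{proj}$, the map $f_X\mathbin\square_{\Sigma_n}\alpha^{\square_2 n}$ is a cofibration of $\overrightarrow{\mathsf{M}}{}^{\square}_{proj}$, where $\square_2$ is the pushout product of maps in the symmetric monoidal category $(\overrightarrow{\mathsf{M}},\square)$.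 -/

import Mathlib

open CategoryTheory MonoidalCategory Limits HomotopicalAlgebra

universe v u

set_option linter.unusedSectionVars false
set_option linter.unusedSimpArgs false

namespace CategoryTheory.TensorPower
variable {D : Type u} [Category.{v} D] [MonoidalCategory D] [SymmetricCategory D]

/-- `X ⊗ (X ⊗ (⋯ ⊗ (X ⊗ 𝟙)))` with `n` factors `X`. -/
@[reducible] def pow (X : D) : ℕ → D
  | 0 => 𝟙_ D
  | n + 1 => X ⊗ pow X n

/-- Exchange of the first two tensor factors. -/
def swap (X T : D) : X ⊗ (X ⊗ T) ⟶ X ⊗ (X ⊗ T) :=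
  (α_ X X T).inv ≫ (β_ X X).hom ▷ T ≫ (α_ X X T).hom

lemma swap_swap (X T : D) : swap X T ≫ swap X T = 𝟙 _ := by
  simp [swap, ← comp_whiskerRight_assoc]

lemma swap_nat (X : D) {T T' : D} (f : T ⟶ T') :
    swap X T ≫ X ◁ X ◁ f = X ◁ X ◁ f ≫ swap X T' := by
  simp only [swap, Category.assoc]
  rw [← associator_naturality_right, ← whisker_exchange_assoc,
    ← associator_inv_naturality_right_assoc]

lemma swap_yb (X T : D) : swap X (X ⊗ T) ≫ X ◁ swap X T ≫ swap X (X ⊗ T) =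
    X ◁ swap X T ≫ swap X (X ⊗ T) ≫ X ◁ swap X T := by
  have h := congrArg (· ▷ T) (BraidedCategory.yang_baxter' X X X)
  calc _ = 𝟙 _ ⊗≫ ((β_ X X).hom ▷ X ⊗≫ X ◁ (β_ X X).hom ⊗≫ (β_ X X).hom ▷ X) ▷ T ⊗≫ 𝟙 _ := by
        simp only [swap]; monoidal
    _ = _ := by
        rw [BraidedCategory.yang_baxter']
        simp only [swap]; monoidal

/-- Move the `i`-th tensor factor to the front. -/
def front (X : D) : (n : ℕ) → Fin (n + 1) → (X ⊗ pow X n ⟶ X ⊗ pow X n)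
  | 0, _ => 𝟙 _
  | n + 1, i => Fin.cases (𝟙 _) (fun j ↦ X ◁ front X n j ≫ swap X (pow X n)) i

/-- `σ` with `j` removed from the source and `σ j` from the target, reindexed in order. -/
def rem {n : ℕ} (σ : Equiv.Perm (Fin (n + 1))) (j : Fin (n + 1)) : Equiv.Perm (Fin n) :=
  (finSuccAboveEquiv j).trans ((σ.subtypeEquiv (by simp)).trans (finSuccAboveEquiv (σ j)).symm)

lemma succAbove_rem {n : ℕ} (σ : Equiv.Perm (Fin (n + 1))) (j : Fin (n + 1)) (k : Fin n) :
    (σ j).succAbove (rem σ j k) = σ (j.succAbove k) := by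
  have := (finSuccAboveEquiv (σ j)).apply_symm_apply
    ((σ.subtypeEquiv (p := (· ≠ j)) (q := (· ≠ σ j)) (by simp)) (finSuccAboveEquiv j k))
  exact congrArg Subtype.val this

/-- The symmetry of the tensor power whose `k`-th factor of the target is the
`σ k`-th factor of the source. -/
def perm (X : D) : (n : ℕ) → Equiv.Perm (Fin n) → (pow X n ⟶ pow X n)
  | 0, _ => 𝟙 _
  | n + 1, σ => front X n (σ 0) ≫ X ◁ perm X n (rem σ 0)

lemma front_zero (X : D) (n : ℕ) : front X n 0 = 𝟙 _ := by cases n <;> rfl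
lemma front_succ (X : D) (n : ℕ) (j : Fin (n+1)) :
  front X (n+1) j.succ = X ◁ front X n j ≫ swap X (pow X n) := rfl

lemma front_front (X : D) (n : ℕ) : (a a' : Fin (n + 2)) → (b b' : Fin (n + 1)) →
    a.succAbove b = a' → a'.succAbove b' = a →
    front X (n+1) a ≫ X ◁ front X n b ≫ swap X (pow X n) =
      front X (n+1) a' ≫ X ◁ front X n b' := by
  induction n with
  | zero =>
    intro a a' b b' h h'
    obtain rfl := Fin.fin_one_eq_zero b
    obtain rfl := Fin.fin_one_eq_zero b'
    cases a using Fin.cases with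
    | zero =>
      subst h
      rw [Fin.succAbove_zero]
      simp only [front_zero, front_succ, Category.id_comp, MonoidalCategory.whiskerLeft_id,
        Category.comp_id]
    | succ a =>
      obtain rfl := Fin.fin_one_eq_zero a
      subst h
      rw [Fin.succ_succAbove_zero]
      simp only [front_zero, front_succ, Category.id_comp, MonoidalCategory.whiskerLeft_id,
        Category.comp_id, swap_swap]
  | succ n ih =>
    intro a a' b b' h h'
    cases a using Fin.cases with
    | zero =>
      subst h
      rw [Fin.succAbove_zero] at h' ⊢
      obtain rfl : b' = 0 := by
        apply Fin.succAbove_right_injective (p := b.succ)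
        rw [h', Fin.succ_succAbove_zero]
      simp [front_zero, front_succ]
    | succ a =>
      cases b using Fin.cases with
      | zero =>
        rw [Fin.succ_succAbove_zero] at h
        subst h
        rw [Fin.succAbove_zero] at h'
        obtain rfl := Fin.succ_injective _ h'
        simp [front_zero, front_succ, swap_swap]
      | succ b =>
        rw [Fin.succ_succAbove_succ] at h
        subst h
        cases b' using Fin.cases with
        | zero => rw [Fin.succ_succAbove_zero] at h'; exact absurd h'.symm (Fin.succ_ne_zero _)
        | succ b' =>
          rw [Fin.succ_succAbove_succ] at h'
          have e := ih a _ b b' rfl (Fin.succ_injective _ h')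
          have e' := congrArg (X ◁ ·) e
          simp only [MonoidalCategory.whiskerLeft_comp] at e'
          simp only [front_succ, Category.assoc, MonoidalCategory.whiskerLeft_comp]
          have n1 := swap_nat X (front X n b)
          have n2 := swap_nat X (front X n b')
          have yb := swap_yb X (pow X n)
          change X ◁ front X (n+1) a ≫ swap X (X ⊗ pow X n) ≫ X ◁ X ◁ front X n b ≫
            X ◁ swap X (pow X n) ≫ swap X (X ⊗ pow X n) =
            X ◁ front X (n+1) _ ≫ swap X (X ⊗ pow X n) ≫ X ◁ X ◁ front X n b' ≫
            X ◁ swap X (pow X n)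
          rw [reassoc_of% n1, reassoc_of% n2, yb, reassoc_of% e']

lemma rem_rem {n : ℕ} (σ : Equiv.Perm (Fin (n + 2))) (k : Fin (n + 1)) :
    rem (rem σ k.succ) 0 = rem (rem σ 0) k := by
  ext m : 1
  have h1 : ((σ k.succ).succAbove ((rem σ k.succ) 0)) = σ 0 := by
    rw [succAbove_rem, Fin.succ_succAbove_zero]
  have h2 : (σ 0).succAbove (rem σ 0 k) = σ k.succ := by
    rw [succAbove_rem, Fin.succAbove_zero]
  have h3 : (σ k.succ).succAbove ((rem σ k.succ 0).succAbove (rem (rem σ k.succ) 0 m)) =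
      (σ 0).succAbove ((rem σ 0 k).succAbove (rem (rem σ 0) k m)) := by
    rw [succAbove_rem, succAbove_rem, succAbove_rem, succAbove_rem, Fin.succAbove_zero,
      Fin.succAbove_zero, Fin.succ_succAbove_succ]
  have h4 : rem σ k.succ 0 = (rem σ 0 k).predAbove (σ 0) := by
    apply Fin.succAbove_right_injective (p := σ k.succ)
    rw [h1, ← h2, Fin.succAbove_succAbove_predAbove]
  rw [h4, ← h2, Fin.succAbove_succAbove_succAbove_predAbove] at h3
  exact Fin.succAbove_right_injective (Fin.succAbove_right_injective h3)

lemma perm_front (X : D) (n : ℕ) (σ : Equiv.Perm (Fin (n + 1))) (j : Fin (n + 1)) :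
    perm X (n + 1) σ ≫ front X n j = front X n (σ j) ≫ X ◁ perm X n (rem σ j) := by
  induction n with
  | zero =>
    obtain rfl := Fin.fin_one_eq_zero j
    exact Category.comp_id _
  | succ n ih =>
    cases j using Fin.cases with
    | zero => rw [front_zero]; exact Category.comp_id _
    | succ k =>
      have e := congrArg (X ◁ ·) (ih (rem σ 0) k)
      have n1 := swap_nat X (perm X n (rem (rem σ 0) k))
      have ff := front_front X n (σ 0) (σ k.succ) (rem σ 0 k) (rem σ k.succ 0)
        (by rw [succAbove_rem, Fin.succAbove_zero])
        (by rw [succAbove_rem, Fin.succ_succAbove_zero])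
      simp only [MonoidalCategory.whiskerLeft_comp] at e
      change (front X (n+1) (σ 0) ≫ X ◁ perm X (n+1) (rem σ 0)) ≫
        X ◁ front X n k ≫ swap X (pow X n) = front X (n+1) (σ k.succ) ≫
        X ◁ (front X n (rem σ k.succ 0) ≫ X ◁ perm X n (rem (rem σ k.succ) 0))
      rw [Category.assoc, reassoc_of% e, rem_rem, ← n1, MonoidalCategory.whiskerLeft_comp,
        ← reassoc_of% ff]

lemma rem_mul {n : ℕ} (σ τ : Equiv.Perm (Fin (n + 1))) (j : Fin (n + 1)) :
    rem (σ * τ) j = rem σ (τ j) * rem τ j := by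
  ext m : 1
  apply Fin.succAbove_right_injective (p := (σ * τ) j)
  rw [succAbove_rem]
  simp only [Equiv.Perm.mul_apply]
  rw [succAbove_rem, succAbove_rem]

lemma perm_mul (X : D) (n : ℕ) (σ τ : Equiv.Perm (Fin n)) :
    perm X n (σ * τ) = perm X n σ ≫ perm X n τ := by
  induction n with
  | zero => exact (Category.comp_id _).symm
  | succ n ih =>
    have h := perm_front X n σ (τ 0)
    change front X n (σ (τ 0)) ≫ X ◁ perm X n (rem (σ * τ) 0) = perm X (n + 1) σ ≫
      front X n (τ 0) ≫ X ◁ perm X n (rem τ 0)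
    rw [reassoc_of% h, rem_mul, ih, MonoidalCategory.whiskerLeft_comp]

lemma perm_one (X : D) (n : ℕ) : perm X n 1 = 𝟙 _ := by
  induction n with
  | zero => rfl
  | succ n ih =>
    have : rem (1 : Equiv.Perm (Fin (n + 1))) 0 = 1 := by
      ext m : 1
      apply Fin.succAbove_right_injective (p := (0 : Fin (n + 1)))
      exact succAbove_rem (1 : Equiv.Perm (Fin (n + 1))) 0 m
    change front X n 0 ≫ X ◁ perm X n (rem 1 0) = _
    rw [this, ih, front_zero]
    simp

/-- The `n`-th tensor power of `X` with the left action of `Σ_n` permuting the factors: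
`σ` moves the `k`-th factor to the position `σ k`. -/
def powAction (X : D) (n : ℕ) : SingleObj (Equiv.Perm (Fin n)) ⥤ D where
  obj _ := pow X n
  map σ := perm X n (σ : Equiv.Perm (Fin n))⁻¹
  map_id _ := by
    rw [← perm_one X n]
    rfl
  map_comp σ τ := by
    rw [← perm_mul, ← mul_inv_rev]
    rfl
end CategoryTheory.TensorPower

namespace PushoutProduct
noncomputable section
variable {C : Type u} [Category.{v} C] [MonoidalCategory C] [HasPushouts C]

/-- The domain `(A₁ ⊗ B₀) ⊔_{A₀ ⊗ B₀} (A₀ ⊗ B₁)` of the pushout product. -/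
def dom (A B : Arrow C) : C := pushout (A.hom ▷ B.left) (A.left ◁ B.hom)

/-- The inclusion of `A₁ ⊗ B₀`. -/
def inl (A B : Arrow C) : A.right ⊗ B.left ⟶ dom A B := pushout.inl _ _
/-- The inclusion of `A₀ ⊗ B₁`. -/
def inr (A B : Arrow C) : A.left ⊗ B.right ⟶ dom A B := pushout.inr _ _

lemma isPushout (A B : Arrow C) :
    IsPushout (A.hom ▷ B.left) (A.left ◁ B.hom) (inl A B) (inr A B) :=
  IsPushout.of_hasPushout _ _

lemma w (A B : Arrow C) : A.hom ▷ B.left ≫ inl A B = A.left ◁ B.hom ≫ inr A B :=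
  pushout.condition

lemma w_assoc (A B : Arrow C) {Z : C} (h : dom A B ⟶ Z) :
    A.hom ▷ B.left ≫ inl A B ≫ h = A.left ◁ B.hom ≫ inr A B ≫ h :=
  pushout.condition_assoc _

/-- Maps out of the domain of the pushout product. -/
def desc {A B : Arrow C} {Z : C} (a : A.right ⊗ B.left ⟶ Z) (b : A.left ⊗ B.right ⟶ Z)
    (h : A.hom ▷ B.left ≫ a = A.left ◁ B.hom ≫ b) : dom A B ⟶ Z := pushout.desc a b h

section
variable {A B : Arrow C} {Z : C} (a : A.right ⊗ B.left ⟶ Z) (b : A.left ⊗ B.right ⟶ Z)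
    (h : A.hom ▷ B.left ≫ a = A.left ◁ B.hom ≫ b) {W : C} (k : Z ⟶ W)

@[simp] lemma inl_desc : inl A B ≫ desc a b h = a := pushout.inl_desc _ _ _
@[simp] lemma inr_desc : inr A B ≫ desc a b h = b := pushout.inr_desc _ _ _
@[simp] lemma inl_desc_assoc : inl A B ≫ desc a b h ≫ k = a ≫ k := pushout.inl_desc_assoc _ _ _ _
@[simp] lemma inr_desc_assoc : inr A B ≫ desc a b h ≫ k = b ≫ k := pushout.inr_desc_assoc _ _ _ _
end

lemma dom_ext {A B : Arrow C} {Z : C} {f g : dom A B ⟶ Z} (h : inl A B ≫ f = inl A B ≫ g)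
    (h' : inr A B ≫ f = inr A B ≫ g) : f = g := pushout.hom_ext h h'

/-- The pushout product of `A` and `B`, as a map to `A₁ ⊗ B₁`. -/
def corner (A B : Arrow C) : dom A B ⟶ A.right ⊗ B.right :=
  desc (A.right ◁ B.hom) (A.hom ▷ B.right) (whisker_exchange _ _).symm

@[simp] lemma inl_corner (A B : Arrow C) : inl A B ≫ corner A B = A.right ◁ B.hom :=
  inl_desc _ _ _
@[simp] lemma inr_corner (A B : Arrow C) : inr A B ≫ corner A B = A.hom ▷ B.right :=
  inr_desc _ _ _
@[simp] lemma inl_corner_assoc (A B : Arrow C) {Z : C} (h : _ ⟶ Z) :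
    inl A B ≫ corner A B ≫ h = A.right ◁ B.hom ≫ h :=
  inl_desc_assoc _ _ _ _
@[simp] lemma inr_corner_assoc (A B : Arrow C) {Z : C} (h : _ ⟶ Z) :
    inr A B ≫ corner A B ≫ h = A.hom ▷ B.right ≫ h :=
  inr_desc_assoc _ _ _ _

/-- The pushout product as an object of the arrow category. -/
abbrev obj (A B : Arrow C) : Arrow C := Arrow.mk (corner A B)

/-- The functoriality of `dom A B` in `B`. -/
def wL (A : Arrow C) {B B' : Arrow C} (f : B ⟶ B') : dom A B ⟶ dom A B' :=
  desc (A.right ◁ f.left ≫ inl A B') (A.left ◁ f.right ≫ inr A B')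
    (by rw [← whisker_exchange_assoc, w, ← whiskerLeft_comp_assoc, ← whiskerLeft_comp_assoc,
      Arrow.w])

/-- The functoriality of `dom A B` in `A`. -/
def wR {A A' : Arrow C} (f : A ⟶ A') (B : Arrow C) : dom A B ⟶ dom A' B :=
  desc (f.right ▷ B.left ≫ inl A' B) (f.left ▷ B.right ≫ inr A' B)
    (by rw [whisker_exchange_assoc, ← w, ← comp_whiskerRight_assoc, ← comp_whiskerRight_assoc,
      Arrow.w])

section
variable (A : Arrow C) {B B' : Arrow C} (f : B ⟶ B') {Z : C} (h : dom A B' ⟶ Z)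
@[simp] lemma inl_wL : inl A B ≫ wL A f = A.right ◁ f.left ≫ inl A B' := inl_desc _ _ _
@[simp] lemma inr_wL : inr A B ≫ wL A f = A.left ◁ f.right ≫ inr A B' := inr_desc _ _ _
@[simp] lemma inl_wL_assoc : inl A B ≫ wL A f ≫ h = A.right ◁ f.left ≫ inl A B' ≫ h := by
  rw [← Category.assoc, inl_wL, Category.assoc]
@[simp] lemma inr_wL_assoc : inr A B ≫ wL A f ≫ h = A.left ◁ f.right ≫ inr A B' ≫ h := by
  rw [← Category.assoc, inr_wL, Category.assoc]
end
section
variable {A A' : Arrow C} (f : A ⟶ A') (B : Arrow C) {Z : C} (h : dom A' B ⟶ Z)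
@[simp] lemma inl_wR : inl A B ≫ wR f B = f.right ▷ B.left ≫ inl A' B := inl_desc _ _ _
@[simp] lemma inr_wR : inr A B ≫ wR f B = f.left ▷ B.right ≫ inr A' B := inr_desc _ _ _
@[simp] lemma inl_wR_assoc : inl A B ≫ wR f B ≫ h = f.right ▷ B.left ≫ inl A' B ≫ h := by
  rw [← Category.assoc, inl_wR, Category.assoc]
@[simp] lemma inr_wR_assoc : inr A B ≫ wR f B ≫ h = f.left ▷ B.right ≫ inr A' B ≫ h := by
  rw [← Category.assoc, inr_wR, Category.assoc]
end

/-- The functoriality of the pushout product in the second variable. -/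
abbrev whiskerLeft (A : Arrow C) {B B' : Arrow C} (f : B ⟶ B') : obj A B ⟶ obj A B' :=
  Arrow.homMk (wL A f) (A.right ◁ f.right)
    (by
      apply dom_ext
      · simp [← MonoidalCategory.whiskerLeft_comp]
      · simp [whisker_exchange])

/-- The functoriality of the pushout product in the first variable. -/
abbrev whiskerRight {A A' : Arrow C} (f : A ⟶ A') (B : Arrow C) : obj A B ⟶ obj A' B :=
  Arrow.homMk (wR f B) (f.right ▷ B.right)
    (by
      apply dom_ext
      · simp [← whisker_exchange]
      · simp [← MonoidalCategory.comp_whiskerRight])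

lemma w_right (A B D : Arrow C) :
    A.hom ▷ dom B D ≫ inl A (obj B D) = A.left ◁ corner B D ≫ inr A (obj B D) := w A (obj B D)
lemma w_left (A B D : Arrow C) :
    corner A B ▷ D.left ≫ inl (obj A B) D = dom A B ◁ D.hom ≫ inr (obj A B) D := w (obj A B) D

variable [MonoidalClosed C] [SymmetricCategory C]

lemma isPushout_left (X : C) (A B : Arrow C) :
    IsPushout (X ◁ A.hom ▷ B.left) (X ◁ A.left ◁ B.hom) (X ◁ inl A B) (X ◁ inr A B) :=
  (isPushout A B).map (tensorLeft X)
lemma isPushout_right (A B : Arrow C) (X : C) :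
    IsPushout ((A.hom ▷ B.left) ▷ X) ((A.left ◁ B.hom) ▷ X) (inl A B ▷ X) (inr A B ▷ X) :=
  (isPushout A B).map (tensorRight X)

lemma right_ext {A B : Arrow C} {X Z : C} {f g : dom A B ⊗ X ⟶ Z}
    (h : inl A B ▷ X ≫ f = inl A B ▷ X ≫ g)
    (h' : inr A B ▷ X ≫ f = inr A B ▷ X ≫ g) : f = g := (isPushout_right A B X).hom_ext h h'
lemma left_ext {A B : Arrow C} {X Z : C} {f g : X ⊗ dom A B ⟶ Z}
    (h : X ◁ inl A B ≫ f = X ◁ inl A B ≫ g)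
    (h' : X ◁ inr A B ≫ f = X ◁ inr A B ≫ g) : f = g := (isPushout_left X A B).hom_ext h h'
lemma right_right_ext {A B : Arrow C} {X Y Z : C} {f g : (dom A B ⊗ X) ⊗ Y ⟶ Z}
    (h : inl A B ▷ X ▷ Y ≫ f = inl A B ▷ X ▷ Y ≫ g)
    (h' : inr A B ▷ X ▷ Y ≫ f = inr A B ▷ X ▷ Y ≫ g) : f = g :=
  ((isPushout_right A B X).map (tensorRight Y)).hom_ext h h'

/-- First half of the associator -/
def assocAux (A B D : Arrow C) : dom A B ⊗ D.right ⟶ dom A (obj B D) :=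
  (isPushout_right A B D.right).desc
    ((α_ _ _ _).hom ≫ A.right ◁ inr B D ≫ inl A (obj B D))
    ((α_ _ _ _).hom ≫ inr A (obj B D))
    (by
      have h' := congrArg (A.left ◁ inr B D ≫ ·) (w_right A B D)
      simp only [whisker_exchange_assoc, ← whiskerLeft_comp_assoc, inr_corner] at h'
      rw [associator_naturality_left_assoc, associator_naturality_middle_assoc]
      exact congrArg ((α_ _ _ _).hom ≫ ·) h')

section
variable (A B D : Arrow C) {Z : C} (h : dom A (obj B D) ⟶ Z)
@[simp] lemma inl_assocAux : inl A B ▷ D.right ≫ assocAux A B D =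
    (α_ _ _ _).hom ≫ A.right ◁ inr B D ≫ inl A (obj B D) := IsPushout.inl_desc _ _ _ _
@[simp] lemma inr_assocAux : inr A B ▷ D.right ≫ assocAux A B D =
    (α_ _ _ _).hom ≫ inr A (obj B D) := IsPushout.inr_desc _ _ _ _
@[simp] lemma inl_assocAux_assoc : inl A B ▷ D.right ≫ assocAux A B D ≫ h =
    (α_ _ _ _).hom ≫ A.right ◁ inr B D ≫ inl A (obj B D) ≫ h := by
  rw [← Category.assoc, inl_assocAux]; simp
@[simp] lemma inr_assocAux_assoc : inr A B ▷ D.right ≫ assocAux A B D ≫ h =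
    (α_ _ _ _).hom ≫ inr A (obj B D) ≫ h := by
  rw [← Category.assoc, inr_assocAux]; simp
end

def assocInvAux (A B D : Arrow C) : A.right ⊗ dom B D ⟶ dom (obj A B) D :=
  (isPushout_left A.right B D).desc
    ((α_ _ _ _).inv ≫ inl (obj A B) D)
    ((α_ _ _ _).inv ≫ inl A B ▷ D.right ≫ inr (obj A B) D)
    (by
      have h' := congrArg (inl A B ▷ D.left ≫ ·) (w_left A B D)
      simp only [← whisker_exchange_assoc, ← comp_whiskerRight_assoc, inl_corner] at h'
      rw [associator_inv_naturality_middle_assoc, associator_inv_naturality_right_assoc]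
      exact congrArg ((α_ _ _ _).inv ≫ ·) h')

section
variable (A B D : Arrow C) {Z : C} (h : dom (obj A B) D ⟶ Z)
@[simp] lemma inl_assocInvAux : A.right ◁ inl B D ≫ assocInvAux A B D =
    (α_ _ _ _).inv ≫ inl (obj A B) D := IsPushout.inl_desc _ _ _ _
@[simp] lemma inr_assocInvAux : A.right ◁ inr B D ≫ assocInvAux A B D =
    (α_ _ _ _).inv ≫ inl A B ▷ D.right ≫ inr (obj A B) D := IsPushout.inr_desc _ _ _ _
@[simp] lemma inl_assocInvAux_assoc : A.right ◁ inl B D ≫ assocInvAux A B D ≫ h =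
    (α_ _ _ _).inv ≫ inl (obj A B) D ≫ h := by
  rw [← Category.assoc, inl_assocInvAux]; simp
@[simp] lemma inr_assocInvAux_assoc : A.right ◁ inr B D ≫ assocInvAux A B D ≫ h =
    (α_ _ _ _).inv ≫ inl A B ▷ D.right ≫ inr (obj A B) D ≫ h := by
  rw [← Category.assoc, inr_assocInvAux]; simp
end

def assocHom (A B D : Arrow C) : dom (obj A B) D ⟶ dom A (obj B D) :=
  desc (A := obj A B) ((α_ A.right B.right D.left).hom ≫ A.right ◁ inl B D ≫ inl A (obj B D))
    (assocAux A B D)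
    (by
      change corner A B ▷ D.left ≫ (α_ _ _ _).hom ≫ A.right ◁ inl B D ≫ inl A (obj B D) =
        dom A B ◁ D.hom ≫ assocAux A B D
      apply right_ext
      · rw [← whisker_exchange_assoc, inl_assocAux, ← comp_whiskerRight_assoc, inl_corner,
          associator_naturality_middle_assoc, associator_naturality_right_assoc,
          ← whiskerLeft_comp_assoc, ← whiskerLeft_comp_assoc, w]
      · rw [← whisker_exchange_assoc, inr_assocAux, ← comp_whiskerRight_assoc, inr_corner,
          associator_naturality_left_assoc, associator_naturality_right_assoc,
          ← whisker_exchange_assoc, w_right, ← whiskerLeft_comp_assoc, inl_corner])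

def assocInv (A B D : Arrow C) : dom A (obj B D) ⟶ dom (obj A B) D :=
  desc (B := obj B D) (assocInvAux A B D)
    ((α_ A.left B.right D.right).inv ≫ inr A B ▷ D.right ≫ inr (obj A B) D)
    (by
      change A.hom ▷ dom B D ≫ assocInvAux A B D =
        A.left ◁ corner B D ≫ (α_ _ _ _).inv ≫ inr A B ▷ D.right ≫ inr (obj A B) D
      apply left_ext
      · rw [whisker_exchange_assoc, inl_assocInvAux, ← whiskerLeft_comp_assoc, inl_corner,
          associator_inv_naturality_left_assoc, associator_inv_naturality_right_assoc,
          whisker_exchange_assoc, ← w_left, ← comp_whiskerRight_assoc, inr_corner]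
      · rw [whisker_exchange_assoc, inr_assocInvAux, ← whiskerLeft_comp_assoc, inr_corner,
          associator_inv_naturality_left_assoc, associator_inv_naturality_middle_assoc,
          ← comp_whiskerRight_assoc, ← comp_whiskerRight_assoc, w])

section
variable (A B D : Arrow C) {Z : C} (h : dom A (obj B D) ⟶ Z)
@[simp] lemma inl_assocHom : inl (obj A B) D ≫ assocHom A B D =
    (α_ A.right B.right D.left).hom ≫ A.right ◁ inl B D ≫ inl A (obj B D) := inl_desc _ _ _
@[simp] lemma inr_assocHom : inr (obj A B) D ≫ assocHom A B D = assocAux A B D := inr_desc _ _ _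
@[simp] lemma inl_assocHom_assoc : inl (obj A B) D ≫ assocHom A B D ≫ h =
    (α_ A.right B.right D.left).hom ≫ A.right ◁ inl B D ≫ inl A (obj B D) ≫ h := by
  rw [← Category.assoc, inl_assocHom]; simp
@[simp] lemma inr_assocHom_assoc : inr (obj A B) D ≫ assocHom A B D ≫ h = assocAux A B D ≫ h := by
  rw [← Category.assoc, inr_assocHom]
end
section
variable (A B D : Arrow C) {Z : C} (h : dom (obj A B) D ⟶ Z)
@[simp] lemma inl_assocInv : inl A (obj B D) ≫ assocInv A B D = assocInvAux A B D := inl_desc _ _ _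
@[simp] lemma inr_assocInv : inr A (obj B D) ≫ assocInv A B D =
    (α_ A.left B.right D.right).inv ≫ inr A B ▷ D.right ≫ inr (obj A B) D := inr_desc _ _ _
@[simp] lemma inl_assocInv_assoc : inl A (obj B D) ≫ assocInv A B D ≫ h = assocInvAux A B D ≫ h :=
  by rw [← Category.assoc, inl_assocInv]
@[simp] lemma inr_assocInv_assoc : inr A (obj B D) ≫ assocInv A B D ≫ h =
    (α_ A.left B.right D.right).inv ≫ inr A B ▷ D.right ≫ inr (obj A B) D ≫ h := by
  rw [← Category.assoc, inr_assocInv]; simp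
end

lemma assocHom_assocInv (A B D : Arrow C) : assocHom A B D ≫ assocInv A B D = 𝟙 _ := by
  apply dom_ext
  · simp
  · apply right_ext
    · simp
    · simp
lemma assocInv_assocHom (A B D : Arrow C) : assocInv A B D ≫ assocHom A B D = 𝟙 _ := by
  apply dom_ext
  · apply left_ext
    · simp
    · simp
  · simp

/-- The associator of the pushout product, given by the associator of `C` on targets. -/
def associator (A B D : Arrow C) : obj (obj A B) D ≅ obj A (obj B D) :=
  Arrow.isoMk ⟨assocHom A B D, assocInv A B D, assocHom_assocInv A B D, assocInv_assocHom A B D⟩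
    (α_ A.right B.right D.right) (by
      change assocHom A B D ≫ corner A (obj B D) = corner (obj A B) D ≫ (α_ _ _ _).hom
      apply dom_ext
      · simp [← MonoidalCategory.whiskerLeft_comp]
      · apply right_ext
        · simp [← MonoidalCategory.whiskerLeft_comp, ← comp_whiskerRight_assoc]
        · simp [← comp_whiskerRight_assoc])

/-- The object `∅ ⊗ X` is initial. -/
def initialTensor (X : C) [HasInitial C] : IsInitial ((⊥_ C) ⊗ X) :=
  IsInitial.isInitialObj (tensorRight X) _ initialIsInitial

/-- The object `X ⊗ ∅` is initial. -/
def tensorInitial (X : C) [HasInitial C] : IsInitial (X ⊗ (⊥_ C)) :=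
  IsInitial.isInitialObj (tensorLeft X) _ initialIsInitial

section unit
variable [HasInitial C]
variable (C) in
/-- The unit `∅ ⟶ 𝟙`. -/
abbrev unit : Arrow C := Arrow.mk (initial.to (𝟙_ C))

/-- The right unitor on sources. -/
def ruHom (A : Arrow C) : dom A (unit C) ⟶ A.left :=
  desc (B := unit C) ((tensorInitial A.right).to _) (ρ_ A.left).hom
    ((tensorInitial A.left).hom_ext _ _)

/-- The left unitor on sources. -/
def luHom (A : Arrow C) : dom (unit C) A ⟶ A.left :=
  desc (A := unit C) (λ_ A.left).hom ((initialTensor A.right).to _)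
    ((initialTensor A.left).hom_ext _ _)

@[simp] lemma inr_ruHom (A : Arrow C) : inr A (unit C) ≫ ruHom A = (ρ_ A.left).hom :=
  inr_desc _ _ _
@[simp] lemma inl_luHom (A : Arrow C) : inl (unit C) A ≫ luHom A = (λ_ A.left).hom :=
  inl_desc _ _ _
@[simp] lemma inr_ruHom_assoc (A : Arrow C) {Z : C} (h : A.left ⟶ Z) :
    inr A (unit C) ≫ ruHom A ≫ h = (ρ_ A.left).hom ≫ h := inr_desc_assoc _ _ _ _
@[simp] lemma inl_luHom_assoc (A : Arrow C) {Z : C} (h : A.left ⟶ Z) :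
    inl (unit C) A ≫ luHom A ≫ h = (λ_ A.left).hom ≫ h := inl_desc_assoc _ _ _ _

/-- The right unitor of the pushout product. -/
def rightUnitor (A : Arrow C) : obj A (unit C) ≅ A :=
  Arrow.isoMk
    ⟨ruHom A, (ρ_ A.left).inv ≫ inr A (unit C), by
      apply dom_ext
      · exact (tensorInitial A.right).hom_ext _ _
      · simp, by simp⟩ (ρ_ A.right) (by
      change ruHom A ≫ A.hom = corner _ _ ≫ (ρ_ _).hom
      apply dom_ext
      · exact (tensorInitial A.right).hom_ext _ _
      · simp)

/-- The left unitor of the pushout product. -/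
def leftUnitor (A : Arrow C) : obj (unit C) A ≅ A :=
  Arrow.isoMk
    ⟨luHom A, (λ_ A.left).inv ≫ inl (unit C) A, by
      apply dom_ext
      · simp
      · exact (initialTensor A.right).hom_ext _ _, by simp⟩ (λ_ A.right) (by
      change luHom A ≫ A.hom = corner _ _ ≫ (λ_ _).hom
      apply dom_ext
      · simp
      · exact (initialTensor A.right).hom_ext _ _)

/-- The pushout product monoidal structure on the arrow category: data. -/
instance monoidalCategoryStruct : MonoidalCategoryStruct (Arrow C) where
  tensorObj := obj
  whiskerLeft A _ _ f := whiskerLeft A f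
  whiskerRight f B := whiskerRight f B
  tensorUnit := unit C
  associator := associator
  leftUnitor := leftUnitor
  rightUnitor := rightUnitor

lemma wL_id (A B : Arrow C) : wL A (𝟙 B) = 𝟙 _ := by
  apply dom_ext <;> simp
lemma id_wR (A B : Arrow C) : wR (𝟙 A) B = 𝟙 _ := by
  apply dom_ext <;> simp
lemma wL_comp (A : Arrow C) {B B' B'' : Arrow C} (f : B ⟶ B') (g : B' ⟶ B'') :
    wL A (f ≫ g) = wL A f ≫ wL A g := by
  apply dom_ext <;> simp
lemma comp_wR {A A' A'' : Arrow C} (f : A ⟶ A') (g : A' ⟶ A'') (B : Arrow C) :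
    wR (f ≫ g) B = wR f B ≫ wR g B := by
  apply dom_ext <;> simp
lemma wL_wR {A A' B B' : Arrow C} (f : A ⟶ A') (g : B ⟶ B') :
    wL A g ≫ wR f B' = wR f B ≫ wL A' g := by
  apply dom_ext <;> simp [whisker_exchange_assoc]

lemma whiskerRight_square {X Y Z : C} {a : X ⟶ Y} {b : Y ⟶ Z} {k : X ⟶ Z}
    (e : a ≫ b = k) (W : C) {V : C} (h : Z ⊗ W ⟶ V) :
    a ▷ W ≫ b ▷ W ≫ h = k ▷ W ≫ h := by
  rw [← comp_whiskerRight_assoc, e]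

lemma whiskerLeft_square {X Y Z : C} {a : X ⟶ Y} {b : Y ⟶ Z} {k : X ⟶ Z}
    (e : a ≫ b = k) (W : C) {V : C} (h : W ⊗ Z ⟶ V) :
    W ◁ a ≫ W ◁ b ≫ h = W ◁ k ≫ h := by
  rw [← whiskerLeft_comp_assoc, e]

lemma assoc_naturality_left {A A' : Arrow C} (f : A ⟶ A') (B D : Arrow C) :
    wR (whiskerRight f B) D ≫ assocHom A' B D = assocHom A B D ≫ wR f (obj B D) := by
  apply dom_ext
  · simp [whisker_exchange_assoc]
  · apply right_ext
    · simp [whiskerRight_square (inl_wR f B), whisker_exchange_assoc]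
    · simp [whiskerRight_square (inr_wR f B)]

lemma assoc_naturality_middle (A : Arrow C) {B B' : Arrow C} (f : B ⟶ B') (D : Arrow C) :
    wR (whiskerLeft A f) D ≫ assocHom A B' D = assocHom A B D ≫ wL A (whiskerRight f D) := by
  apply dom_ext
  · simp [whiskerLeft_square (inl_wR f D)]
  · apply right_ext
    · simp [whiskerRight_square (inl_wL A f), whiskerLeft_square (inr_wR f D)]
    · simp [whiskerRight_square (inr_wL A f)]

lemma assoc_naturality_right (A B : Arrow C) {D D' : Arrow C} (f : D ⟶ D') :
    wL (obj A B) f ≫ assocHom A B D' = assocHom A B D ≫ wL A (whiskerLeft B f) := by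
  apply dom_ext
  · simp [whiskerLeft_square (inl_wL B f)]
  · apply right_ext
    · simp [← whisker_exchange_assoc, whiskerLeft_square (inr_wL B f)]
    · simp [← whisker_exchange_assoc]

lemma associator_hom_left (A B D : Arrow C) : (associator A B D).hom.left = assocHom A B D := rfl
lemma associator_hom_right (A B D : Arrow C) :
    (associator A B D).hom.right = (α_ A.right B.right D.right).hom := rfl
lemma leftUnitor_hom_left (A : Arrow C) : (leftUnitor A).hom.left = luHom A := rfl
lemma leftUnitor_hom_right (A : Arrow C) : (leftUnitor A).hom.right = (λ_ A.right).hom := rfl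
lemma rightUnitor_hom_left (A : Arrow C) : (rightUnitor A).hom.left = ruHom A := rfl
lemma rightUnitor_hom_right (A : Arrow C) : (rightUnitor A).hom.right = (ρ_ A.right).hom := rfl

lemma assoc_pentagon (A B D E : Arrow C) :
    wR (associator A B D).hom E ≫ assocHom A (obj B D) E ≫ wL A (associator B D E).hom =
      assocHom (obj A B) D E ≫ assocHom A B (obj D E) := by
  apply dom_ext
  · simp [associator_hom_left, associator_hom_right, whiskerLeft_square (inl_assocHom _ _ _)]
  · apply right_ext
    · simp [associator_hom_left, associator_hom_right,
        whiskerRight_square (inl_assocHom _ _ _), whiskerLeft_square (inr_assocHom _ _ _),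
        whiskerLeft_square (inl_assocAux _ _ _)]
    · apply right_right_ext
      · simp only [associator_hom_left, associator_hom_right, inr_wR_assoc, inr_assocHom_assoc,
          whiskerRight_square (inr_assocHom _ _ _), inr_assocAux_assoc, inr_assocHom,
          Arrow.mk_left]
        have e := inl_assocAux A B (obj D E)
        change inl A B ▷ (D.right ⊗ E.right) ≫ _ = _ at e
        rw [associator_naturality_left_assoc, e,
          whiskerRight_square (inl_assocAux _ _ _)]
        simp [associator_hom_left, whiskerLeft_square (inr_assocHom _ _ _),
          whiskerLeft_square (inr_assocAux _ _ _)]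
      · simp only [associator_hom_left, associator_hom_right, inr_wR_assoc, inr_assocHom_assoc,
          whiskerRight_square (inr_assocHom _ _ _), inr_assocAux_assoc, inr_assocHom,
          Arrow.mk_left]
        have e := inr_assocAux A B (obj D E)
        change inr A B ▷ (D.right ⊗ E.right) ≫ _ = _ at e
        rw [associator_naturality_left_assoc, e,
          whiskerRight_square (inr_assocAux _ _ _)]
        simp [associator_hom_right]

lemma assoc_triangle (A B : Arrow C) :
    assocHom A (unit C) B ≫ wL A (leftUnitor B).hom = wR (rightUnitor A).hom B := by
  apply dom_ext
  · simp [leftUnitor_hom_left, rightUnitor_hom_right, whiskerLeft_square (inl_luHom _)]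
  · apply right_ext
    · exact (IsInitial.isInitialObj (tensorRight B.right) _ (tensorInitial A.right)).hom_ext _ _
    · simp [leftUnitor_hom_right, rightUnitor_hom_left, whiskerRight_square (inr_ruHom _)]

/-- The pushout product monoidal structure on the arrow category. -/
instance monoidalCategory : MonoidalCategory (Arrow C) where
  tensorHom_def _ _ := rfl
  id_tensorHom_id A B := by
    refine Arrow.hom_ext _ _ ?_ ?_
    · change wR (𝟙 A) B ≫ wL A (𝟙 B) = 𝟙 _
      rw [id_wR, wL_id, Category.comp_id]
    · change 𝟙 A.right ▷ B.right ≫ A.right ◁ 𝟙 B.right = 𝟙 _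
      simp
  tensorHom_comp_tensorHom {A₁ B₁ D₁ A₂ B₂ D₂} f₁ f₂ g₁ g₂ := by
    refine Arrow.hom_ext _ _ ?_ ?_
    · change (wR f₁ A₂ ≫ wL B₁ f₂) ≫ (wR g₁ B₂ ≫ wL D₁ g₂) = wR (f₁ ≫ g₁) A₂ ≫ wL D₁ (f₂ ≫ g₂)
      rw [comp_wR, wL_comp, Category.assoc, Category.assoc]
      have := wL_wR g₁ f₂
      rw [reassoc_of% this]
    · change (f₁.right ▷ A₂.right ≫ B₁.right ◁ f₂.right) ≫
        (g₁.right ▷ B₂.right ≫ D₁.right ◁ g₂.right) =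
        (f₁.right ≫ g₁.right) ▷ A₂.right ≫ D₁.right ◁ (f₂.right ≫ g₂.right)
      simp [whisker_exchange_assoc]
  whiskerLeft_id A B := by
    refine Arrow.hom_ext _ _ (wL_id A B) (MonoidalCategory.whiskerLeft_id _ _)
  id_whiskerRight A B := by
    refine Arrow.hom_ext _ _ (id_wR A B) (MonoidalCategory.id_whiskerRight _ _)
  associator_naturality {A₁ A₂ A₃ B₁ B₂ B₃} f₁ f₂ f₃ := by
    refine Arrow.hom_ext _ _ ?_ ?_
    · change (wR (whiskerRight f₁ A₂ ≫ whiskerLeft B₁ f₂) A₃ ≫ wL (obj B₁ B₂) f₃) ≫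
        assocHom B₁ B₂ B₃ = assocHom A₁ A₂ A₃ ≫ wR f₁ (obj A₂ A₃) ≫
          wL B₁ (whiskerRight f₂ A₃ ≫ whiskerLeft B₂ f₃)
      have h := assoc_naturality_left f₁ A₂ A₃
      have h' := assoc_naturality_middle B₁ f₂ A₃
      rw [comp_wR, wL_comp, Category.assoc, Category.assoc, assoc_naturality_right,
        reassoc_of% h', reassoc_of% h]
    · have := MonoidalCategory.associator_naturality f₁.right f₂.right f₃.right
      simp only [MonoidalCategory.tensorHom_def] at this
      exact this
  leftUnitor_naturality {A B} f := by
    refine Arrow.hom_ext _ _ ?_ (MonoidalCategory.leftUnitor_naturality f.right)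
    change wL (unit C) f ≫ luHom B = luHom A ≫ f.left
    apply dom_ext
    · simp
    · exact (initialTensor A.right).hom_ext _ _
  rightUnitor_naturality {A B} f := by
    refine Arrow.hom_ext _ _ ?_ (MonoidalCategory.rightUnitor_naturality f.right)
    change wR f (unit C) ≫ ruHom B = ruHom A ≫ f.left
    apply dom_ext
    · exact (tensorInitial A.right).hom_ext _ _
    · simp
  pentagon A B D E := Arrow.hom_ext _ _ (assoc_pentagon A B D E)
    (MonoidalCategory.pentagon A.right B.right D.right E.right)
  triangle A B := Arrow.hom_ext _ _ (assoc_triangle A B)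
    (MonoidalCategory.triangle A.right B.right)

/-- The braiding on sources. -/
def braid (A B : Arrow C) : dom A B ⟶ dom B A :=
  desc ((β_ _ _).hom ≫ inr B A) ((β_ _ _).hom ≫ inl B A) (by
    rw [BraidedCategory.braiding_naturality_left_assoc, ← w,
      BraidedCategory.braiding_naturality_right_assoc])

section
variable (A B : Arrow C) {Z : C} (h : dom B A ⟶ Z)
@[simp] lemma inl_braid : inl A B ≫ braid A B = (β_ _ _).hom ≫ inr B A := inl_desc _ _ _
@[simp] lemma inr_braid : inr A B ≫ braid A B = (β_ _ _).hom ≫ inl B A := inr_desc _ _ _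
@[simp] lemma inl_braid_assoc : inl A B ≫ braid A B ≫ h = (β_ _ _).hom ≫ inr B A ≫ h := by
  rw [← Category.assoc, inl_braid, Category.assoc]
@[simp] lemma inr_braid_assoc : inr A B ≫ braid A B ≫ h = (β_ _ _).hom ≫ inl B A ≫ h := by
  rw [← Category.assoc, inr_braid, Category.assoc]
end

lemma braid_braid (A B : Arrow C) : braid A B ≫ braid B A = 𝟙 _ := by
  apply dom_ext <;> simp

/-- The symmetry of the pushout product, given by the symmetry of `C` on targets. -/
def braiding (A B : Arrow C) : obj A B ≅ obj B A :=
  Arrow.isoMk ⟨braid A B, braid B A, braid_braid A B, braid_braid B A⟩ (β_ A.right B.right) (by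
    change braid A B ≫ corner B A = corner A B ≫ (β_ _ _).hom
    apply dom_ext <;> simp)

lemma braid_hexagon (A B D : Arrow C) :
    assocHom A B D ≫ braid A (obj B D) ≫ assocHom B D A =
      wR (braiding A B).hom D ≫ assocHom B A D ≫ wL B (braiding A D).hom := by
  have hl (X Y : Arrow C) : (braiding X Y).hom.left = braid X Y := rfl
  have hr (X Y : Arrow C) : (braiding X Y).hom.right = (β_ X.right Y.right).hom := rfl
  apply dom_ext
  · simp [hl, hr, whiskerLeft_square (inl_braid _ _)]
  · apply right_ext
    · simp only [hl, hr, inr_assocHom_assoc, inl_assocAux_assoc, inl_braid_assoc, inr_wR_assoc,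
        whiskerRight_square (inl_braid _ _), MonoidalCategory.comp_whiskerRight, Category.assoc,
        inr_assocAux_assoc, inr_wL]
      simp
    · simp [hl, whiskerRight_square (inr_braid _ _)]
      have e := whiskerLeft_square (inr_braid A D) B.right (inl B (obj D A))
      simp only [MonoidalCategory.whiskerLeft_comp, Category.assoc] at e
      exact congrArg (fun t ↦ _ ≫ _ ≫ t) e.symm

/-- The pushout product monoidal structure is symmetric. -/
instance symmetricCategory : SymmetricCategory (Arrow C) where
  braiding := braiding
  braiding_naturality_right A B D f := by
    refine Arrow.hom_ext _ _ ?_ (BraidedCategory.braiding_naturality_right A.right f.right)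
    change wL A f ≫ braid A D = braid A B ≫ wR f A
    apply dom_ext <;> simp
  braiding_naturality_left {A B} f D := by
    refine Arrow.hom_ext _ _ ?_ (BraidedCategory.braiding_naturality_left f.right D.right)
    change wR f D ≫ braid B D = braid A D ≫ wL D f
    apply dom_ext <;> simp
  hexagon_forward A B D := by
    exact Arrow.hom_ext _ _ (braid_hexagon A B D)
      (BraidedCategory.hexagon_forward A.right B.right D.right)
  hexagon_reverse A B D := by
    have h : α_ D A B ≪≫ braiding D (obj A B) ≪≫ α_ A B D =
        whiskerRightIso (braiding D A) B ≪≫ α_ A D B ≪≫ whiskerLeftIso A (braiding D B) :=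
      Iso.ext (Arrow.hom_ext _ _ (braid_hexagon D A B)
        (BraidedCategory.hexagon_forward D.right A.right B.right))
    have h' := congrArg Iso.inv h
    have hb (X Y : Arrow C) : (braiding X Y).inv = (braiding Y X).hom :=
      Arrow.hom_ext _ _ rfl (SymmetricCategory.braiding_swap_eq_inv_braiding _ _).symm
    simp only [Iso.trans_inv, Category.assoc, hb, whiskerLeftIso_inv, whiskerRightIso_inv] at h'
    exact h'
  symmetry A B := Arrow.hom_ext _ _ (braid_braid A B) (SymmetricCategory.symmetry _ _)

lemma obj_eq (A B : Arrow C) :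
   (MonoidalCategory.Arrow.pushoutProduct.obj A).obj B = obj A B := rfl

lemma map_eq (A : Arrow C) {B B' : Arrow C} (f : B ⟶ B') :
    (MonoidalCategory.Arrow.pushoutProduct.obj A).map f = whiskerLeft A f := by
  refine Arrow.hom_ext _ _ ?_ rfl
  apply dom_ext
  · exact (IsPushout.inl_desc _ _ _ _).trans (inl_wL A f).symm
  · exact (IsPushout.inr_desc _ _ _ _).trans (inr_wL A f).symm

/-- The functor `A ⊗ -` of the pushout product monoidal structure is Mathlib's pushout product
functor. -/
def isoTensorLeft (A : Arrow C) :
    MonoidalCategory.Arrow.pushoutProduct.obj A ≅ tensorLeft A :=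
  NatIso.ofComponents (fun B ↦ Iso.refl (obj A B)) (fun {_ _} f ↦
    (Category.comp_id _).trans ((map_eq A f).trans (Category.id_comp _).symm))

/-- The pushout product monoidal structure is closed. -/
instance monoidalClosed [HasPullbacks C] : MonoidalClosed (Arrow C) where
  closed A :=
    { rightAdj := MonoidalCategory.Arrow.pullbackHom.obj (Opposite.op A)
      adj := (Functor.LeibnizAdjunction.adj _ _
        (MonoidalClosed.internalHomAdjunction₂) A).ofNatIsoLeft (isoTensorLeft A) }
end unit
end
end PushoutProduct

namespace ProjectiveArrow
noncomputable section
variable {C : Type u} [Category.{v} C]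

/-- The pushout corner map `X₁ ⊔_{X₀} Y₀ ⟶ Y₁` of a square `X ⟶ Y`. -/
def latch [HasPushouts C] {X Y : Arrow C} (α : X ⟶ Y) : pushout X.hom α.left ⟶ Y.right :=
  pushout.desc α.right Y.hom (Arrow.w α).symm

lemma inl_latch_assoc [HasPushouts C] {X Y : Arrow C} (α : X ⟶ Y) {Z : C} (h : Y.right ⟶ Z) :
    pushout.inl X.hom α.left ≫ latch α ≫ h = α.right ≫ h := pushout.inl_desc_assoc _ _ _ _

lemma inr_latch_assoc [HasPushouts C] {X Y : Arrow C} (α : X ⟶ Y) {Z : C} (h : Y.right ⟶ Z) :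
    pushout.inr X.hom α.left ≫ latch α ≫ h = Y.hom ≫ h := pushout.inr_desc_assoc _ _ _ _

/-- The class of `α` with `α.left` and `α.right` in `W`. -/
def levelwise (W : MorphismProperty C) : MorphismProperty (Arrow C) :=
  fun _ _ α ↦ W α.left ∧ W α.right

/-- The class of `α` with `α.left` and `latch α` in `W`. -/
def reedy [HasPushouts C] (W : MorphismProperty C) : MorphismProperty (Arrow C) :=
  fun _ _ α ↦ W α.left ∧ W (latch α)

lemma levelwise_isStableUnderRetracts (W : MorphismProperty C) [W.IsStableUnderRetracts] :
    (levelwise W).IsStableUnderRetracts :=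
  inferInstanceAs (W.inverseImage Arrow.leftFunc ⊓ W.inverseImage Arrow.rightFunc
    : MorphismProperty (Arrow C)).IsStableUnderRetracts

lemma levelwise_hasTwoOutOfThreeProperty (W : MorphismProperty C) [W.HasTwoOutOfThreeProperty] :
    (levelwise W).HasTwoOutOfThreeProperty :=
  inferInstanceAs (W.inverseImage Arrow.leftFunc ⊓ W.inverseImage Arrow.rightFunc
    : MorphismProperty (Arrow C)).HasTwoOutOfThreeProperty

variable [HasPushouts C]

lemma hasLiftingProperty {A B X Y : Arrow C} (i : A ⟶ B) (p : X ⟶ Y)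
    (h₀ : HasLiftingProperty i.left p.left) (h₁ : HasLiftingProperty (latch i) p.right) :
    HasLiftingProperty i p where
  sq_hasLift {u v} sq := by
    have sq₀ : CommSq u.left i.left p.left v.left := ⟨congrArg Arrow.Hom.left sq.w⟩
    have sq₁ : CommSq (pushout.desc u.right (sq₀.lift ≫ X.hom) (by
        rw [sq₀.fac_left_assoc, Arrow.w])) (latch i) p.right v.right := ⟨by
      apply pushout.hom_ext
      · rw [pushout.inl_desc_assoc, inl_latch_assoc]
        exact congrArg Arrow.Hom.right sq.w
      · rw [pushout.inr_desc_assoc, inr_latch_assoc, Category.assoc,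
          ← Arrow.w p, sq₀.fac_right_assoc, Arrow.w]⟩
    have e : latch i ≫ sq₁.lift = _ := sq₁.fac_left
    have el : i.right ≫ sq₁.lift = u.right := by
      have h := congrArg (pushout.inl _ _ ≫ ·) e
      rwa [pushout.inl_desc, inl_latch_assoc] at h
    have er : B.hom ≫ sq₁.lift = sq₀.lift ≫ X.hom := by
      have h := congrArg (pushout.inr _ _ ≫ ·) e
      rwa [pushout.inr_desc, inr_latch_assoc] at h
    exact ⟨⟨⟨Arrow.homMk sq₀.lift sq₁.lift er.symm, Arrow.hom_ext _ _ sq₀.fac_left el,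
      Arrow.hom_ext _ _ sq₀.fac_right sq₁.fac_right⟩⟩⟩

lemma isWeakFactorizationSystem [HasTerminal C] (L R : MorphismProperty C)
    [MorphismProperty.IsWeakFactorizationSystem L R] :
    MorphismProperty.IsWeakFactorizationSystem (reedy L) (levelwise R) := by
  have hle : reedy L ≤ (levelwise R).llp := fun _ _ i hi _ _ p hp ↦
    hasLiftingProperty i p (MorphismProperty.hasLiftingProperty_of_wfs _ _ hi.1 hp.1)
      (MorphismProperty.hasLiftingProperty_of_wfs _ _ hi.2 hp.2)
  have hid (X : C) : R (𝟙 X) := by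
    rw [← MorphismProperty.rlp_eq_of_wfs L R]
    exact MorphismProperty.rlp_of_isIso _ _
  have : R.IsStableUnderRetracts := by
    rw [← MorphismProperty.rlp_eq_of_wfs L R]
    infer_instance
  have := levelwise_isStableUnderRetracts R
  have hfac : MorphismProperty.HasFactorization (reedy L) (levelwise R) := ⟨fun {X Y} f ↦ by
    let d₀ := MorphismProperty.factorizationData L R f.left
    let k : pushout X.hom d₀.i ⟶ Y.right := pushout.desc f.right (d₀.p ≫ Y.hom)
      (by rw [d₀.fac_assoc, Arrow.w])
    let d₁ := MorphismProperty.factorizationData L R k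
    let Z : Arrow C := Arrow.mk (pushout.inr X.hom d₀.i ≫ d₁.i)
    let i : X ⟶ Z := Arrow.homMk d₀.i (pushout.inl X.hom d₀.i ≫ d₁.i)
      (pushout.condition_assoc _).symm
    let p : Z ⟶ Y := Arrow.homMk d₀.p d₁.p (by
      change d₀.p ≫ Y.hom = (pushout.inr X.hom d₀.i ≫ d₁.i) ≫ d₁.p
      rw [Category.assoc, d₁.fac, pushout.inr_desc])
    refine ⟨⟨Z, i, p, ?_, ⟨d₀.hi, ?_⟩, ⟨d₀.hp, d₁.hp⟩⟩⟩
    · refine Arrow.hom_ext _ _ d₀.fac ?_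
      change (pushout.inl X.hom d₀.i ≫ d₁.i) ≫ d₁.p = _
      rw [Category.assoc, d₁.fac, pushout.inl_desc]
    · have : latch i = d₁.i := by
        apply pushout.hom_ext
        · exact pushout.inl_desc _ _ _
        · exact pushout.inr_desc _ _ _
      rw [this]
      exact d₁.hi⟩
  refine ⟨?_, ?_, hfac⟩
  · exact MorphismProperty.rlp_eq_of_le_rlp_of_hasFactorization_of_isStableUnderRetracts
      ((MorphismProperty.le_llp_iff_le_rlp _ _).1 hle)
  · refine le_antisymm (fun A B f hf ↦ ⟨?_, ?_⟩) hle
    · rw [← MorphismProperty.llp_eq_of_wfs L R]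
      intro X Y p hp
      constructor
      intro u v sq
      have := hf (X := Arrow.mk (terminal.from X)) (Y := Arrow.mk (terminal.from Y))
        (Arrow.homMk p (𝟙 _) (Subsingleton.elim (α := _ ⟶ ⊤_ C) _ _)) ⟨hp, hid _⟩
      have sq' : CommSq (Arrow.homMk u (terminal.from _) (Subsingleton.elim (α := _ ⟶ ⊤_ C) _ _) :
          A ⟶ Arrow.mk (terminal.from X)) f
        (Arrow.homMk p (𝟙 _) (Subsingleton.elim (α := _ ⟶ ⊤_ C) _ _) :
          Arrow.mk (terminal.from X) ⟶ Arrow.mk (terminal.from Y))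
        (Arrow.homMk v (terminal.from _) (Subsingleton.elim (α := _ ⟶ ⊤_ C) _ _)) :=
        ⟨Arrow.hom_ext _ _ sq.w (Subsingleton.elim (α := _ ⟶ ⊤_ C) _ _)⟩
      exact ⟨⟨⟨sq'.lift.left, congrArg Arrow.Hom.left sq'.fac_left,
        congrArg Arrow.Hom.left sq'.fac_right⟩⟩⟩
    · rw [← MorphismProperty.llp_eq_of_wfs L R]
      intro X Y p hp
      constructor
      intro u v sq
      have := hf (X := Arrow.mk (𝟙 X)) (Y := Arrow.mk p) (Arrow.homMk (𝟙 X) p rfl) ⟨hid _, hp⟩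
      have e₁ : f.right ≫ v = (pushout.inl A.hom f.left ≫ u) ≫ p := by
        rw [Category.assoc, sq.w, inl_latch_assoc]
      have e₂ : (pushout.inr A.hom f.left ≫ u) ≫ p = B.hom ≫ v := by
        rw [Category.assoc, sq.w, inr_latch_assoc]
      have sq' : CommSq (Arrow.homMk (A.hom ≫ pushout.inl A.hom f.left ≫ u)
            (pushout.inl A.hom f.left ≫ u) (Category.comp_id _) : A ⟶ Arrow.mk (𝟙 X)) f
          (Arrow.homMk (𝟙 X) p rfl : Arrow.mk (𝟙 X) ⟶ Arrow.mk p)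
          (Arrow.homMk (pushout.inr A.hom f.left ≫ u) v e₂) :=
        ⟨Arrow.hom_ext _ _ ((Category.comp_id _).trans (pushout.condition_assoc _)) e₁.symm⟩
      refine ⟨⟨⟨sq'.lift.right, ?_, congrArg Arrow.Hom.right sq'.fac_right⟩⟩⟩
      apply pushout.hom_ext
      · rw [inl_latch_assoc]
        exact congrArg Arrow.Hom.right sq'.fac_left
      · rw [inr_latch_assoc, ← Arrow.w sq'.lift]
        exact congrArg Arrow.Hom.left sq'.fac_right

lemma trivialCofibrations_aux [ModelCategory C] :
    reedy (cofibrations C) ⊓ levelwise (weakEquivalences C) = reedy (trivialCofibrations C) := by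
  ext A B f
  have e : pushout.inl A.hom f.left ≫ latch f = f.right := pushout.inl_desc _ _ _
  constructor
  · rintro ⟨⟨h₁, h₂⟩, h₃, h₄⟩
    have : Cofibration f.left := ⟨h₁⟩
    have : WeakEquivalence f.left := ⟨h₃⟩
    exact ⟨⟨h₁, h₃⟩, h₂, (weakEquivalences C).of_precomp _ _
      (mem_weakEquivalences (pushout.inl A.hom f.left)) (by rwa [e])⟩
  · rintro ⟨⟨h₁, h₃⟩, h₂, h₄⟩
    have : Cofibration f.left := ⟨h₁⟩
    have : WeakEquivalence f.left := ⟨h₃⟩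
    refine ⟨⟨h₁, h₂⟩, h₃, ?_⟩
    rw [← e]
    exact (weakEquivalences C).comp_mem _ _ (mem_weakEquivalences _) h₄

/-- The projective model structure on the arrow category: weak equivalences and fibrations are
levelwise, and `α` is a cofibration when `α.left` and its pushout corner map are. -/
instance modelCategory [ModelCategory C] : ModelCategory (Arrow C) :=
  letI : CategoryWithFibrations (Arrow C) := ⟨levelwise (fibrations C)⟩
  letI : CategoryWithCofibrations (Arrow C) := ⟨reedy (cofibrations C)⟩
  letI : CategoryWithWeakEquivalences (Arrow C) := ⟨levelwise (weakEquivalences C)⟩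
  haveI : (weakEquivalences (Arrow C)).HasTwoOutOfThreeProperty :=
    levelwise_hasTwoOutOfThreeProperty _
  haveI : MorphismProperty.IsWeakFactorizationSystem (cofibrations (Arrow C)) (trivialFibrations (Arrow C)) := by
    have h : trivialFibrations (Arrow C) = levelwise (trivialFibrations C) := by
      ext A B f
      exact and_and_and_comm
    rw [h]
    exact isWeakFactorizationSystem _ _
  haveI : MorphismProperty.IsWeakFactorizationSystem (trivialCofibrations (Arrow C)) (fibrations (Arrow C)) := by
    have h : trivialCofibrations (Arrow C) = reedy (trivialCofibrations C) :=
      trivialCofibrations_aux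
    rw [h]
    exact isWeakFactorizationSystem _ _
  ModelCategory.mk' (Arrow C)
end
end ProjectiveArrow

noncomputable section

namespace EquivariantObject

/-- Objects of `C` with a left action of the symmetric group `Σ_n`. (Composition in `SingleObj G` is
`f ≫ g = g * f`, so covariant functors are left actions.) -/
abbrev Left (n : ℕ) (C : Type u) [Category.{v} C] : Type (max u v) :=
  SingleObj (Equiv.Perm (Fin n)) ⥤ C

/-- Objects of `C` with a right action of the symmetric group `Σ_n`. -/
abbrev Right (n : ℕ) (C : Type u) [Category.{v} C] : Type (max u v) :=
  (SingleObj (Equiv.Perm (Fin n)))ᵒᵖ ⥤ C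

variable {n : ℕ} {C : Type u} [Category.{v} C]

/-- The underlying object of a left `Σ_n`-object. -/
abbrev Left.obj (X : Left n C) : C := Functor.obj X (SingleObj.star _)

/-- The underlying map of a map of left `Σ_n`-objects. -/
abbrev Left.hom {X Y : Left n C} (f : X ⟶ Y) : X.obj ⟶ Y.obj := f.app (SingleObj.star _)

/-- The underlying object of a right `Σ_n`-object. -/
abbrev Right.obj (X : Right n C) : C := Functor.obj X (Opposite.op (SingleObj.star _))

/-- The underlying map of a map of right `Σ_n`-objects. -/
abbrev Right.hom {X Y : Right n C} (f : X ⟶ Y) : X.obj ⟶ Y.obj :=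
  f.app (Opposite.op (SingleObj.star _))

/-- The left `Σ_n`-object with `σ` acting as `σ⁻¹` acts on the right `Σ_n`-object `X`. -/
abbrev Right.toLeft (X : Right n C) : Left n C :=
  (Groupoid.invEquivalence (SingleObj (Equiv.Perm (Fin n)))).functor ⋙ X

/-- The same for maps. -/
abbrev Right.toLeftMap {X Y : Right n C} (f : X ⟶ Y) : Right.toLeft X ⟶ Right.toLeft Y :=
  Functor.whiskerLeft (Groupoid.invEquivalence (SingleObj (Equiv.Perm (Fin n)))).functor f

/-- The map induced on `Σ_n`-coinvariants by a `Σ_n`-equivariant map. -/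
abbrev coinvariantsMap [HasFiniteColimits C] {X Y : Left n C} (f : X ⟶ Y) :
    colimit X ⟶ colimit Y :=
  colim.map f

end EquivariantObject

open EquivariantObject

variable {n : ℕ} {C : Type u} [Category.{v} C] [MonoidalCategory C]

/-- The map `f □_{Σ_n} g`: the coinvariants of the pushout product of `f` and `g`
for the diagonal action of `Σ_n`. The pushout product is formed in the category of `Σ_n`-objects,
whose tensor products and pushouts are those of `C` with the induced action. -/
def boxOver [HasFiniteColimits C] {X₀ X₁ : Right n C} (f : X₀ ⟶ X₁) {Y₀ Y₁ : Left n C}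
    (g : Y₀ ⟶ Y₁) :=
  coinvariantsMap (PushoutProduct.corner (Arrow.mk (Right.toLeftMap f)) (Arrow.mk g))

/-- The map `X ⊗_{Σ_n} g`: the coinvariants of `X ⊗ g` for the diagonal action of `Σ_n`. -/
def tensorOver [HasFiniteColimits C] (X : Right n C) {Y₀ Y₁ : Left n C} (g : Y₀ ⟶ Y₁) :
    colimit (X.toLeft ⊗ Y₀) ⟶ colimit (X.toLeft ⊗ Y₁) :=
  coinvariantsMap (X.toLeft ◁ g)

/-- The iterated pushout product `f □ ⋯ □ f` (with `n` factors) with its permutation action, as a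
map of left `Σ_n`-objects. The action lives on the object `f □ ⋯ □ f` of the arrow category with its
pushout product symmetric monoidal structure. -/
def iteratedBox [SymmetricCategory C] [MonoidalClosed C] [HasPushouts C] [HasInitial C]
    {V W : C} (f : V ⟶ W) (n : ℕ) :
    (TensorPower.powAction (Arrow.mk f) n ⋙ Arrow.leftFunc : Left n C) ⟶
      (TensorPower.powAction (Arrow.mk f) n ⋙ Arrow.rightFunc : Left n C) :=
  Functor.whiskerLeft (TensorPower.powAction (Arrow.mk f) n) Arrow.leftToRight

/-- A model category is cofibrantly generated if there are sets `I` of cofibrations and `J` of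
trivial cofibrations which permit the small object argument and such that the (trivial)
fibrations are the maps with the right lifting property with respect to `J` (resp. `I`). -/
class CofibrantlyGenerated (C : Type u) [Category.{v} C] [ModelCategory C] : Prop where
  exists_generators : ∃ I J : MorphismProperty C,
    I ≤ cofibrations C ∧ J ≤ trivialCofibrations C ∧
    MorphismProperty.HasSmallObjectArgument.{v} I ∧
    MorphismProperty.HasSmallObjectArgument.{v} J ∧
    fibrations C = J.rlp ∧ trivialFibrations C = I.rlp

/-- The pushout product axiom. -/
class PushoutProductAxiom (C : Type u) [Category.{v} C] [MonoidalCategory C]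
    [ModelCategory C] : Prop where
  cofibration {X₀ X₁ Y₀ Y₁ : C} (f : X₀ ⟶ X₁) (g : Y₀ ⟶ Y₁) [Cofibration f] [Cofibration g] :
    Cofibration (PushoutProduct.corner (Arrow.mk f) (Arrow.mk g))
  weakEquivalence {X₀ X₁ Y₀ Y₁ : C} (f : X₀ ⟶ X₁) (g : Y₀ ⟶ Y₁) [Cofibration f] [Cofibration g]
    (h : WeakEquivalence f ∨ WeakEquivalence g) :
    WeakEquivalence (PushoutProduct.corner (Arrow.mk f) (Arrow.mk g))

/-- The cofibrancy condition `(♥)`. -/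
def Heart (C : Type u) [Category.{v} C] [MonoidalCategory C] [ModelCategory C] : Prop :=
  ∀ n : ℕ, 1 ≤ n → ∀ (X₀ X₁ : Right n C) (f : X₀ ⟶ X₁),
    IsCofibrant X₀.obj → IsCofibrant X₁.obj → Cofibration (Right.hom f) →
    ∀ (Y₀ Y₁ : Left n C) (g : Y₀ ⟶ Y₁), Cofibration (Left.hom g) →
      Cofibration (boxOver f g)

/-- The cofibrancy condition `(♣)_cof`. -/
def ClubCof (C : Type u) [Category.{v} C] [MonoidalCategory C] [SymmetricCategory C]
    [MonoidalClosed C] [ModelCategory C] : Prop :=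
  ∀ n : ℕ, 1 ≤ n → ∀ X : Right n C, IsCofibrant X.obj →
    ∀ (V W : C) (f : V ⟶ W), Cofibration f → Cofibration (tensorOver X (iteratedBox f n))

end

/-! Two facts combine. First, `f^{□₂ n}` is an underlying cofibration for every cofibration `f` of
the arrow category (`cofibration_pow`), because projective cofibrations are closed under pushout
products (`cofibration_corner`). Second, under `(♥)` the functor `X ⊗_{Σ_n} -`, for `X` underlying
cofibrant, sends every equivariant map that is an underlying cofibration to a cofibration
(`cofibration_tensorOver`). The second fact uses nothing about the shape of `f^{□₂ n}` beyond its
being an underlying cofibration.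

Both rest on `hasLiftingProperty_corner_arrow`. A square `α` behaves as if built from two generating
squares: `𝟙_A ⟶ 𝟙_B` on its source part and `(∅ ⟶ P) ⟶ (∅ ⟶ Q)` on its corner map `P ⟶ Q`. Lifting
against `p` sees only `p.left` for the first kind and only `p.right` for the second. The pushout
product of two generators is again a generator, on the pushout product of the maps of `K`, and it is
of the second kind only if both factors are. So a lifting problem for `α □ β` against `p` reduces to
four problems in `K`.

With `K = M`, the pushout product axiom of `M` solves all four. For the second fact, take `K` to be
the category of `Σ_n`-objects of `M`. Coinvariants are left adjoint to the trivial action, so a lift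
for `X ⊗_{Σ_n} φ` against `p` is an equivariant lift for `X ⊗ φ`, which is the pushout product of `∅
⟶ X` with `φ`. The source part of `∅ ⟶ X` is `∅ ⟶ X₀` and its corner map is `X₀ ⟶ X₁`. Both are
underlying cofibrations between underlying cofibrant objects, so `(♥)` solves the four problems. -/

namespace PushoutProduct
noncomputable section

/-! ### Pushout products and functors compatible with tensor products -/

section monoidalFunctor
variable {K : Type u} [Category.{v} K] [MonoidalCategory K] [HasPushouts K]

/-- If `F - ⊗ G -` is naturally isomorphic to `H (- ⊗ -)` and `H` preserves pushouts, then the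
pushout product of `F i` and `G j` is isomorphic to the image under `H` of that of `i` and `j`. -/
def cornerMapIso {L : Type*} [Category L] [MonoidalCategory L] [HasPushouts L] {F G H : K ⥤ L}
    [PreservesColimitsOfShape WalkingSpan H]
    (e : ∀ Z Z' : K, F.obj Z ⊗ G.obj Z' ≅ H.obj (Z ⊗ Z'))
    (hF : ∀ {Z Z₁ : K} (f : Z ⟶ Z₁) (Z' : K),
      F.map f ▷ G.obj Z' ≫ (e Z₁ Z').hom = (e Z Z').hom ≫ H.map (f ▷ Z'))
    (hG : ∀ (Z : K) {Z' Z₁ : K} (f : Z' ⟶ Z₁),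
      F.obj Z ◁ G.map f ≫ (e Z Z₁).hom = (e Z Z').hom ≫ H.map (Z ◁ f))
    {A B A' B' : K} (i : A ⟶ B) (j : A' ⟶ B') :
    Arrow.mk (corner (Arrow.mk (F.map i)) (Arrow.mk (G.map j))) ≅
      Arrow.mk (H.map (corner (Arrow.mk i) (Arrow.mk j))) := by
  -- The square defining `i □ j` stays a pushout under `H`; its universal property supplies the
  -- inverse comparison `b`.
  have P := (isPushout (Arrow.mk i) (Arrow.mk j)).map H
  have hF' {Z Z₁ : K} (f : Z ⟶ Z₁) (Z' : K) :
      (e Z Z').inv ≫ F.map f ▷ G.obj Z' = H.map (f ▷ Z') ≫ (e Z₁ Z').inv := by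
    rw [Iso.inv_comp_eq, ← reassoc_of% hF f Z', Iso.hom_inv_id, Category.comp_id]
  have hG' (Z : K) {Z' Z₁ : K} (f : Z' ⟶ Z₁) :
      (e Z Z').inv ≫ F.obj Z ◁ G.map f = H.map (Z ◁ f) ≫ (e Z Z₁).inv := by
    rw [Iso.inv_comp_eq, ← reassoc_of% hG Z f, Iso.hom_inv_id, Category.comp_id]
  let a : dom (Arrow.mk (F.map i)) (Arrow.mk (G.map j)) ⟶
      H.obj (dom (Arrow.mk i) (Arrow.mk j)) :=
    desc (A := Arrow.mk (F.map i)) (B := Arrow.mk (G.map j))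
      ((e B A').hom ≫ H.map (inl (Arrow.mk i) (Arrow.mk j)))
      ((e A B').hom ≫ H.map (inr (Arrow.mk i) (Arrow.mk j))) (by
        have h1 := hF i A'
        have h2 := hG A j
        dsimp
        rw [reassoc_of% h1, reassoc_of% h2, ← H.map_comp, ← H.map_comp]
        exact congrArg (fun t ↦ _ ≫ H.map t) (w (Arrow.mk i) (Arrow.mk j)))
  let b : H.obj (dom (Arrow.mk i) (Arrow.mk j)) ⟶
      dom (Arrow.mk (F.map i)) (Arrow.mk (G.map j)) :=
    P.desc ((e B A').inv ≫ inl (Arrow.mk (F.map i)) (Arrow.mk (G.map j)))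
      ((e A B').inv ≫ inr (Arrow.mk (F.map i)) (Arrow.mk (G.map j))) (by
        have h1 := hF' i A'
        have h2 := hG' A j
        dsimp
        rw [← reassoc_of% h1, ← reassoc_of% h2]
        exact congrArg (_ ≫ ·) (w (Arrow.mk (F.map i)) (Arrow.mk (G.map j))))
  refine Arrow.isoMk ⟨a, b, ?_, ?_⟩ (e B B') ?_
  · apply dom_ext
    · erw [inl_desc_assoc, Category.assoc, P.inl_desc, Iso.hom_inv_id_assoc, Category.comp_id]
    · erw [inr_desc_assoc, Category.assoc, P.inr_desc, Iso.hom_inv_id_assoc, Category.comp_id]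
  · apply P.hom_ext
    · erw [P.inl_desc_assoc, Category.assoc, inl_desc, Iso.inv_hom_id_assoc, Category.comp_id]
    · erw [P.inr_desc_assoc, Category.assoc, inr_desc, Iso.inv_hom_id_assoc, Category.comp_id]
  · change a ≫ H.map _ = corner _ _ ≫ (e B B').hom
    apply dom_ext
    · erw [inl_desc_assoc, inl_corner_assoc, Category.assoc, ← H.map_comp, inl_corner, hG]
      rfl
    · erw [inr_desc_assoc, inr_corner_assoc, Category.assoc, ← H.map_comp, inr_corner, hF]
      rfl

end monoidalFunctor

/-! ### The two families of generating arrows, as left adjoints -/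

section generators
variable (K : Type u) [Category.{v} K]

/-- The functor `Z ↦ (𝟙 : Z ⟶ Z)`. -/
def diag : K ⥤ Arrow K where
  obj Z := Arrow.mk (𝟙 Z)
  map f := Arrow.homMk f f (by simp)

/-- The functor `Z ↦ (∅ ⟶ Z)`. -/
def ofInitial [HasInitial K] : K ⥤ Arrow K where
  obj Z := Arrow.mk (initial.to Z)
  map f := Arrow.homMk (𝟙 _) f (by simp)

/-- Maps from `𝟙_Z` to an arrow are maps from `Z` to its source. -/
def diagAdj : diag K ⊣ Arrow.leftFunc :=
  Adjunction.mkOfHomEquiv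
    { homEquiv _ Y :=
        { toFun f := f.left
          invFun g := Arrow.homMk g (g ≫ Y.hom) (Category.id_comp (g ≫ Y.hom)).symm
          left_inv f := Arrow.hom_ext _ _ rfl ((Arrow.w f).trans (Category.id_comp _))
          right_inv _ := rfl }
      homEquiv_naturality_left_symm _ _ := Arrow.hom_ext _ _ rfl (Category.assoc _ _ _)
      homEquiv_naturality_right _ _ := rfl }

/-- Maps from `∅ ⟶ Z` to an arrow are maps from `Z` to its target. -/
def ofInitialAdj [HasInitial K] : ofInitial K ⊣ Arrow.rightFunc :=
  Adjunction.mkOfHomEquiv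
    { homEquiv _ _ :=
        { toFun f := f.right
          invFun g := Arrow.homMk (initial.to _) g (initialIsInitial.hom_ext _ _)
          left_inv _ := Arrow.hom_ext _ _ (initialIsInitial.hom_ext _ _) rfl
          right_inv _ := rfl }
      homEquiv_naturality_left_symm _ _ := Arrow.hom_ext _ _ (initialIsInitial.hom_ext _ _) rfl
      homEquiv_naturality_right _ _ := rfl }

end generators

/-! ### Lifting properties of pushout products of squares -/

section lifting
variable {K : Type u} [Category.{v} K] [MonoidalCategory K] [SymmetricCategory K]
  [MonoidalClosed K] [HasPushouts K] [HasPullbacks K] [HasInitial K]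

/-- Moving `A` to the right by the pullback-hom leaves a lifting problem for `B` alone, so `B` can
be decomposed with `A` held fixed. -/
lemma hasLiftingProperty_corner_iff (A B : Arrow K) {X Y : K} (p : X ⟶ Y) :
    HasLiftingProperty (corner A B) p ↔ HasLiftingProperty B.hom
      ((MonoidalCategory.Arrow.pullbackHom.obj (Opposite.op A)).obj (Arrow.mk p)).hom :=
  MonoidalCategory.Arrow.PushoutProduct.hasLiftingProperty_iff (X := A) (Y := B) (Z := Arrow.mk p)

lemma hasLiftingProperty_corner_comm (A B : Arrow K) {X Y : K} (p : X ⟶ Y) :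
    HasLiftingProperty (corner A B) p ↔ HasLiftingProperty (corner B A) p :=
  HasLiftingProperty.iff_of_arrow_iso_left (braiding A B) p

/-- One leg of the defining span is an identity, so the pushout is `Z ⊗ B₁`, included by `inr`. -/
lemma isIso_corner_id (Z : K) (B : Arrow K) : IsIso (corner (Arrow.mk (𝟙 Z)) B) := by
  refine ⟨inr (Arrow.mk (𝟙 Z)) B, ?_, ?_⟩
  · apply dom_ext
    · have := w (Arrow.mk (𝟙 Z)) B
      rw [inl_corner_assoc, Category.comp_id]
      dsimp at this ⊢
      rw [← this, id_whiskerRight, Category.id_comp]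
    · rw [inr_corner_assoc, Category.comp_id]
      dsimp
      rw [id_whiskerRight, Category.id_comp]
  · rw [inr_corner]
    exact id_whiskerRight _ _

/-- The pushout product `𝟙_Z □ B` is the identity of `Z ⊗ B₁`. -/
def diagTensor (Z : K) (B : Arrow K) : (diag K).obj Z ⊗ B ≅ (diag K).obj (Z ⊗ B.right) :=
  Arrow.isoMk (@asIso _ _ _ _ (corner (Arrow.mk (𝟙 Z)) B) (isIso_corner_id Z B)) (Iso.refl _) rfl

/-- The source component of `diagTensor` is the corner map itself, so naturality on sources is the
commutative square of a map of arrows; on targets the components are identities. -/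
lemma diagTensor_naturality_left {Z Z₁ : K} (f : Z ⟶ Z₁) (B : Arrow K) :
    (diag K).map f ▷ B ≫ (diagTensor Z₁ B).hom =
      (diagTensor Z B).hom ≫ (diag K).map (f ▷ B.right) :=
  Arrow.hom_ext _ _ (Arrow.w (whiskerRight ((diag K).map f) B))
    ((Category.comp_id _).trans (Category.id_comp _).symm)

lemma diagTensor_naturality_right (Z : K) {B B' : Arrow K} (f : B ⟶ B') :
    (diag K).obj Z ◁ f ≫ (diagTensor Z B').hom =
      (diagTensor Z B).hom ≫ (diag K).map (Z ◁ f.right) :=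
  Arrow.hom_ext _ _ (Arrow.w (whiskerLeft ((diag K).obj Z) f))
    ((Category.comp_id _).trans (Category.id_comp _).symm)

/-- The source of the pushout product of `∅ ⟶ Z` and `∅ ⟶ Z'` is initial. -/
def isInitialDom (Z Z' : K) : IsInitial (dom (Arrow.mk (initial.to Z)) (Arrow.mk (initial.to Z'))) :=
  -- The glued objects `Z ⊗ ∅` and `∅ ⊗ Z'`, and `∅ ⊗ ∅` along which they are glued, are all
  -- initial, since tensoring preserves initial objects in a closed category.
  IsInitial.ofUniqueHom (fun _ ↦ desc ((tensorInitial Z).to _) ((initialTensor Z').to _)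
    ((tensorInitial _).hom_ext _ _))
    (fun _ _ ↦ dom_ext ((tensorInitial Z).hom_ext _ _) ((initialTensor Z').hom_ext _ _))

/-- The pushout product of `∅ ⟶ Z` and `∅ ⟶ Z'` is `∅ ⟶ Z ⊗ Z'`. -/
def ofInitialTensor (Z Z' : K) :
    (ofInitial K).obj Z ⊗ (ofInitial K).obj Z' ≅ (ofInitial K).obj (Z ⊗ Z') :=
  Arrow.isoMk ((isInitialDom Z Z').uniqueUpToIso initialIsInitial) (Iso.refl _)
    ((isInitialDom Z Z').hom_ext _ _)

lemma ofInitialTensor_naturality_left {Z Z₁ : K} (f : Z ⟶ Z₁) (Z' : K) :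
    (ofInitial K).map f ▷ (ofInitial K).obj Z' ≫ (ofInitialTensor Z₁ Z').hom =
      (ofInitialTensor Z Z').hom ≫ (ofInitial K).map (f ▷ Z') :=
  Arrow.hom_ext _ _ ((isInitialDom Z Z').hom_ext _ _)
    ((Category.comp_id _).trans (Category.id_comp _).symm)

lemma ofInitialTensor_naturality_right (Z : K) {Z' Z₁ : K} (f : Z' ⟶ Z₁) :
    (ofInitial K).obj Z ◁ (ofInitial K).map f ≫ (ofInitialTensor Z Z₁).hom =
      (ofInitialTensor Z Z').hom ≫ (ofInitial K).map (Z ◁ f) :=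
  Arrow.hom_ext _ _ ((isInitialDom Z Z').hom_ext _ _)
    ((Category.comp_id _).trans (Category.id_comp _).symm)

variable {A B A' B' : K} (i : A ⟶ B) (j : A' ⟶ B') {X Y : Arrow K} (p : X ⟶ Y)

/-- `diag` carries `i □ j` to `diag i □ diag j` up to isomorphism, and its right adjoint reads off
the source of `p`. -/
lemma hasLiftingProperty_diag_diag_iff :
    HasLiftingProperty (corner (Arrow.mk ((diag K).map i)) (Arrow.mk ((diag K).map j))) p ↔
      HasLiftingProperty (corner (Arrow.mk i) (Arrow.mk j)) p.left := by
  have := (diagAdj K).leftAdjoint_preservesColimits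
  rw [HasLiftingProperty.iff_of_arrow_iso_left (cornerMapIso (F := diag K) (G := diag K)
    (H := diag K) (fun Z Z' ↦ diagTensor Z ((diag K).obj Z'))
    (fun f Z' ↦ diagTensor_naturality_left f ((diag K).obj Z'))
    (fun Z _ _ f ↦ diagTensor_naturality_right Z ((diag K).map f)) i j) p]
  exact (diagAdj K).hasLiftingProperty_iff _ _

/-- `𝟙_Z □ B` depends on `B` only through its target, and the target of `∅ ⟶ Z'` is `Z'`. A mixed
product is therefore of `diag` type, which is why `p.left` appears. -/
lemma hasLiftingProperty_diag_ofInitial_iff :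
    HasLiftingProperty (corner (Arrow.mk ((diag K).map i)) (Arrow.mk ((ofInitial K).map j))) p ↔
      HasLiftingProperty (corner (Arrow.mk i) (Arrow.mk j)) p.left := by
  have := (diagAdj K).leftAdjoint_preservesColimits
  rw [HasLiftingProperty.iff_of_arrow_iso_left (cornerMapIso (F := diag K) (G := ofInitial K)
    (H := diag K) (fun Z Z' ↦ diagTensor Z ((ofInitial K).obj Z'))
    (fun f Z' ↦ diagTensor_naturality_left f ((ofInitial K).obj Z'))
    (fun Z _ _ f ↦ diagTensor_naturality_right Z ((ofInitial K).map f)) i j) p]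
  exact (diagAdj K).hasLiftingProperty_iff _ _

/-- This is the only pairing of generators that tests `p.right`. -/
lemma hasLiftingProperty_ofInitial_ofInitial_iff :
    HasLiftingProperty (corner (Arrow.mk ((ofInitial K).map i))
      (Arrow.mk ((ofInitial K).map j))) p ↔
      HasLiftingProperty (corner (Arrow.mk i) (Arrow.mk j)) p.right := by
  have := (ofInitialAdj K).leftAdjoint_preservesColimits
  rw [HasLiftingProperty.iff_of_arrow_iso_left (cornerMapIso (F := ofInitial K) (G := ofInitial K)
    (H := ofInitial K) ofInitialTensor ofInitialTensor_naturality_left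
    ofInitialTensor_naturality_right i j) p]
  exact (ofInitialAdj K).hasLiftingProperty_iff _ _

/-- In the second variable, lifting properties of pushout products in the arrow category can be
checked on the generating maps built from the source part and the corner map. -/
lemma hasLiftingProperty_corner_of_generators (P : Arrow (Arrow K)) {V W : Arrow K} (β : V ⟶ W)
    (h₀ : HasLiftingProperty (corner P (Arrow.mk ((diag K).map β.left))) p)
    (h₁ : HasLiftingProperty (corner P (Arrow.mk ((ofInitial K).map
      (ProjectiveArrow.latch β)))) p) :
    HasLiftingProperty (corner P (Arrow.mk β)) p := by
  -- After transposing `P`, the adjunctions for `diag` and `ofInitial` turn the hypotheses into the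
  -- componentwise criterion for lifting `β` against a map of arrows.
  rw [hasLiftingProperty_corner_iff] at h₀ h₁ ⊢
  exact ProjectiveArrow.hasLiftingProperty _ _
    (((diagAdj K).hasLiftingProperty_iff _ _).1 h₀)
    (((ofInitialAdj K).hasLiftingProperty_iff _ _).1 h₁)

/-- A lifting property of the pushout product of two squares follows from those of the four pushout
products of their source parts and corner maps. -/
theorem hasLiftingProperty_corner_arrow {A B V W : Arrow K} (α : A ⟶ B) (β : V ⟶ W)
    (h₀₀ : HasLiftingProperty (corner (Arrow.mk α.left) (Arrow.mk β.left)) p.left)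
    (h₀₁ : HasLiftingProperty
      (corner (Arrow.mk α.left) (Arrow.mk (ProjectiveArrow.latch β))) p.left)
    (h₁₀ : HasLiftingProperty
      (corner (Arrow.mk (ProjectiveArrow.latch α)) (Arrow.mk β.left)) p.left)
    (h₁₁ : HasLiftingProperty
      (corner (Arrow.mk (ProjectiveArrow.latch α)) (Arrow.mk (ProjectiveArrow.latch β))) p.right) :
    HasLiftingProperty (corner (Arrow.mk α) (Arrow.mk β)) p := by
  apply hasLiftingProperty_corner_of_generators
  -- The reduction to generators acts on the second variable; symmetry brings `α` there.
  · rw [hasLiftingProperty_corner_comm]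
    apply hasLiftingProperty_corner_of_generators
    · rwa [hasLiftingProperty_diag_diag_iff, hasLiftingProperty_corner_comm]
    · rwa [hasLiftingProperty_diag_ofInitial_iff, hasLiftingProperty_corner_comm]
  · rw [hasLiftingProperty_corner_comm]
    apply hasLiftingProperty_corner_of_generators
    -- The swap puts the `diag` factor first, as the mixed case requires.
    · rwa [hasLiftingProperty_corner_comm, hasLiftingProperty_diag_ofInitial_iff]
    · rwa [hasLiftingProperty_corner_comm, hasLiftingProperty_ofInitial_ofInitial_iff]

end lifting
end
end PushoutProduct

/-! ### Corner maps and cofibrations in the projective model structure -/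

namespace ProjectiveArrow
noncomputable section

/-- The corner map of `∅ ⟶ A` is `A` itself. -/
def latchInitialIso {K : Type u} [Category.{v} K] [HasPushouts K] [HasInitial K] (A : Arrow K) :
    Arrow.mk (latch (initial.to A)) ≅ A :=
  -- The chosen initial arrow has initial source and target, so it is an isomorphism, and pushing
  -- out along it changes nothing.
  have h : IsInitial (⊥_ (Arrow K)).left :=
    IsInitial.isInitialObj Arrow.leftFunc _ initialIsInitial
  have h' : IsInitial (⊥_ (Arrow K)).right :=
    IsInitial.isInitialObj Arrow.rightFunc _ initialIsInitial
  haveI : IsIso (⊥_ (Arrow K)).hom := isIso_of_isInitial h h' _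
  (Arrow.isoMk (asIso (pushout.inr (⊥_ (Arrow K)).hom (initial.to A).left)) (Iso.refl _)
    (by
      change pushout.inr _ _ ≫ latch (initial.to A) = A.hom ≫ 𝟙 _
      rw [Category.comp_id]
      exact pushout.inr_desc _ _ _) : A ≅ Arrow.mk (latch (initial.to A))).symm

/-- Corner maps are preserved by functors that preserve pushouts. -/
def latchMapIso {K : Type*} [Category K] [HasPushouts K] {L : Type*} [Category L] [HasPushouts L]
    (F : K ⥤ L) [PreservesColimitsOfShape WalkingSpan F] {X Y : Arrow K} (α : X ⟶ Y) :
    Arrow.mk (latch (F.mapArrow.map α)) ≅ Arrow.mk (F.map (latch α)) :=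
  Arrow.isoMk (PreservesPushout.iso F X.hom α.left) (Iso.refl _) (by
    change (PreservesPushout.iso F X.hom α.left).hom ≫ F.map (latch α) =
      latch (F.mapArrow.map α) ≫ 𝟙 _
    rw [Category.comp_id]
    refine pushout.hom_ext ?_ ?_
    · rw [PreservesPushout.inl_iso_hom_assoc, ← F.map_comp]
      exact (congrArg F.map (pushout.inl_desc _ _ _)).trans (pushout.inl_desc _ _ _).symm
    · rw [PreservesPushout.inr_iso_hom_assoc, ← F.map_comp]
      exact (congrArg F.map (pushout.inr_desc _ _ _)).trans (pushout.inr_desc _ _ _).symm)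

variable {M : Type u} [Category.{v} M] [ModelCategory M]

lemma cofibration_iff_left_latch {X Y : Arrow M} (α : X ⟶ Y) :
    Cofibration α ↔ Cofibration α.left ∧ Cofibration (latch α) := by
  simp only [HomotopicalAlgebra.cofibration_iff]
  rfl

lemma mem_trivialFibrations_iff {X Y : Arrow M} (p : X ⟶ Y) :
    trivialFibrations (Arrow M) p ↔
      trivialFibrations M p.left ∧ trivialFibrations M p.right :=
  and_and_and_comm

/-- Lifting properties pass through adjunctions and isomorphisms of arrows, so cofibrations are
handled in this form. -/
lemma cofibration_iff_lifting {X Y : M} (i : X ⟶ Y) :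
    Cofibration i ↔ ∀ ⦃Z W : M⦄ (p : Z ⟶ W), trivialFibrations M p → HasLiftingProperty i p := by
  rw [HomotopicalAlgebra.cofibration_iff, ← trivialFibrations_llp]
  rfl

lemma cofibration_of_arrow_iso {X Y X' Y' : M} {i : X ⟶ Y} {i' : X' ⟶ Y'}
    (e : Arrow.mk i ≅ Arrow.mk i') (h : Cofibration i) : Cofibration i' := by
  rw [HomotopicalAlgebra.cofibration_iff] at h ⊢
  exact ((cofibrations M).arrow_mk_iso_iff e).1 h

lemma isCofibrant_left (A : Arrow M) [h : IsCofibrant A] : IsCofibrant A.left :=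
  (isCofibrant_iff_of_isInitial _
    (IsInitial.isInitialObj Arrow.leftFunc _ initialIsInitial)).2
    ((cofibration_iff_left_latch _).1 h).1

/-- Up to isomorphism `A.hom` is the corner map of `∅ ⟶ A`. -/
lemma cofibration_hom (A : Arrow M) [h : IsCofibrant A] : Cofibration A.hom :=
  cofibration_of_arrow_iso (latchInitialIso A) ((cofibration_iff_left_latch _).1 h).2

lemma isCofibrant_right (A : Arrow M) [IsCofibrant A] : IsCofibrant A.right :=
  haveI := isCofibrant_left A
  haveI := cofibration_hom A
  isCofibrant_of_cofibration A.hom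

variable [MonoidalCategory M] [SymmetricCategory M] [MonoidalClosed M] [PushoutProductAxiom M]

/-- Cofibrations of the projective model structure are closed under pushout products. -/
theorem cofibration_corner {A B V W : Arrow M} (α : A ⟶ B) (β : V ⟶ W)
    (hα : Cofibration α) (hβ : Cofibration β) :
    Cofibration (PushoutProduct.corner (Arrow.mk α) (Arrow.mk β)) := by
  rw [cofibration_iff_left_latch] at hα hβ
  rw [cofibration_iff_lifting]
  intro Z W p hp
  rw [mem_trivialFibrations_iff] at hp
  -- The pushout product axiom of `M` settles all four component problems.
  have key {X₀ X₁ Y₀ Y₁ Z W : M} (f : X₀ ⟶ X₁) (g : Y₀ ⟶ Y₁) (q : Z ⟶ W) (hf : Cofibration f)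
      (hg : Cofibration g) (hq : trivialFibrations M q) :
      HasLiftingProperty (PushoutProduct.corner (Arrow.mk f) (Arrow.mk g)) q :=
    (cofibration_iff_lifting _).1 (PushoutProductAxiom.cofibration f g) q hq
  exact PushoutProduct.hasLiftingProperty_corner_arrow _ _ _
    (key _ _ _ hα.1 hβ.1 hp.1) (key _ _ _ hα.1 hβ.2 hp.1) (key _ _ _ hα.2 hβ.1 hp.1)
    (key _ _ _ hα.2 hβ.2 hp.2)

/-- Iterated pushout products of a cofibration of the projective model structure are
cofibrations. -/
lemma cofibration_pow {V W : Arrow M} (f : V ⟶ W) (hf : Cofibration f) (n : ℕ) :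
    Cofibration (TensorPower.pow (Arrow.mk f) (n + 1)).hom := by
  induction n with
  -- The induction starts at one factor, `A ⊗ 𝟙 ≅ A`. The empty power is the unit `∅ ⟶ 𝟙`, which
  -- need not be a cofibration.
  | zero => exact cofibration_of_arrow_iso (PushoutProduct.rightUnitor (Arrow.mk f)).symm hf
  | succ n ih => exact cofibration_corner _ _ hf ih

end
end ProjectiveArrow

/-! ### Tensoring as a pushout product, and maps on sources -/

namespace PushoutProduct
noncomputable section
variable {K : Type u} [Category.{v} K] [MonoidalCategory K] [SymmetricCategory K]
  [MonoidalClosed K] [HasPushouts K] [HasInitial K]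

/-- The pushout product with `∅ ⟶ X` is the tensor product with `X`. -/
def initialCornerIso (X : K) (B : Arrow K) :
    Arrow.mk (corner (Arrow.mk (initial.to X)) B) ≅ Arrow.mk (X ◁ B.hom) :=
  -- A map between the initial objects `∅ ⊗ B₀` and `∅ ⊗ B₁` is invertible, hence so is its pushout
  -- `inl`.
  haveI : IsIso ((Arrow.mk (initial.to X)).left ◁ B.hom) := isIso_of_isInitial (initialTensor _) (initialTensor _) _
  haveI : IsIso (inl (Arrow.mk (initial.to X)) B) :=
    (isPushout (Arrow.mk (initial.to X)) B).isIso_inl_of_isIso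
  (Arrow.isoMk (asIso (inl (Arrow.mk (initial.to X)) B)) (Iso.refl _)
    ((inl_corner (Arrow.mk (initial.to X)) B).trans (Category.comp_id _).symm) :
    Arrow.mk (X ◁ B.hom) ≅ Arrow.mk (corner (Arrow.mk (initial.to X)) B)).symm

end
end PushoutProduct

namespace PushoutProduct
variable {K : Type u} [Category.{v} K] [MonoidalCategory K] [SymmetricCategory K]
  [MonoidalClosed K] [HasPushouts K] [HasInitial K]

/-- With its `inr` counterpart, this makes the inclusions into pointwise pushout products natural,
as `domComparison` needs. -/
lemma inl_tensorHom_left {A A' B B' : Arrow K} (f : A ⟶ A') (g : B ⟶ B') :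
    inl A B ≫ (f ⊗ₘ g).left = (f.right ⊗ₘ g.left) ≫ inl A' B' := by
  change inl A B ≫ wR f B ≫ wL A' g = _
  rw [inl_wR_assoc, inl_wL, MonoidalCategory.tensorHom_def, Category.assoc]

lemma inr_tensorHom_left {A A' B B' : Arrow K} (f : A ⟶ A') (g : B ⟶ B') :
    inr A B ≫ (f ⊗ₘ g).left = (f.left ⊗ₘ g.right) ≫ inr A' B' := by
  change inr A B ≫ wR f B ≫ wL A' g = _
  rw [inr_wR_assoc, inr_wL, MonoidalCategory.tensorHom_def, Category.assoc]

end PushoutProduct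

/-! ### Diagrams of arrows versus arrows of diagrams -/

namespace EquivariantObject
noncomputable section

/-- Compatibility with the inclusions forces `k` to be the canonical comparison of two pushouts of
one span. -/
lemma isIso_of_isPushout {K : Type*} [Category K] {A B B' P P' : K} {f : A ⟶ B} {g : A ⟶ B'}
    {i : B ⟶ P} {j : B' ⟶ P} {i' : B ⟶ P'} {j' : B' ⟶ P'} (h : IsPushout f g i j)
    (h' : IsPushout f g i' j') (k : P ⟶ P') (hi : i ≫ k = i') (hj : j ≫ k = j') : IsIso k := by
  have e : k = (h.isoIsPushout _ _ h').hom := h.hom_ext (by simp [hi]) (by simp [hj])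
  rw [e]
  infer_instance

section diagrams
variable (J : Type*) [Category J] (M : Type u) [Category.{v} M]

/-- Diagrams of arrows as arrows of diagrams. -/
def toArrow : (J ⥤ Arrow M) ⥤ Arrow (J ⥤ M) where
  obj P := Arrow.mk (Functor.whiskerLeft P Arrow.leftToRight)
  map θ := Arrow.homMk (Functor.whiskerRight θ Arrow.leftFunc)
    (Functor.whiskerRight θ Arrow.rightFunc) (by
      ext j
      exact Arrow.w (θ.app j))

/-- Maps of arrows of diagrams are maps of diagrams of arrows. -/
def toArrowFullyFaithful : (toArrow J M).FullyFaithful where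
  preimage f :=
    { app j := Arrow.homMk (f.left.app j) (f.right.app j) (congrArg (NatTrans.app · j) (Arrow.w f))
      naturality _ _ t :=
        Arrow.hom_ext _ _ (f.left.naturality t) (f.right.naturality t) }
  map_preimage _ := rfl
  preimage_map _ := rfl

variable {J M}

/-- Full faithfulness of `toArrow` pulls the diagonal filler back. -/
lemma hasLiftingProperty_of_toArrow {A B X Y : J ⥤ Arrow M} (i : A ⟶ B) (p : X ⟶ Y)
    (h : HasLiftingProperty ((toArrow J M).map i) ((toArrow J M).map p)) :
    HasLiftingProperty i p where
  sq_hasLift sq := by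
    have sq' := sq.map (toArrow J M)
    let F := toArrowFullyFaithful J M
    exact ⟨⟨⟨F.preimage sq'.lift, F.map_injective (((toArrow J M).map_comp _ _).trans
      ((congrArg (_ ≫ ·) (F.map_preimage _)).trans sq'.fac_left)),
      F.map_injective (((toArrow J M).map_comp _ _).trans
      ((congrArg (· ≫ _) (F.map_preimage _)).trans sq'.fac_right))⟩⟩⟩

variable [MonoidalCategory M] [SymmetricCategory M] [MonoidalClosed M] [HasPushouts M]
  [HasInitial M]

/-- The comparison of the pointwise pushout product with the pushout product of diagrams, on
sources. -/
def domComparison (X D : J ⥤ Arrow M) :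
    PushoutProduct.dom ((toArrow J M).obj X) ((toArrow J M).obj D) ⟶ (X ⊗ D) ⋙ Arrow.leftFunc :=
  PushoutProduct.desc (A := (toArrow J M).obj X) (B := (toArrow J M).obj D)
    (Z := (X ⊗ D) ⋙ Arrow.leftFunc)
    { app j := PushoutProduct.inl (X.obj j) (D.obj j)
      naturality _ _ t := (PushoutProduct.inl_tensorHom_left (X.map t) (D.map t)).symm }
    { app j := PushoutProduct.inr (X.obj j) (D.obj j)
      naturality _ _ t := (PushoutProduct.inr_tensorHom_left (X.map t) (D.map t)).symm }
    (by
      ext j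
      exact PushoutProduct.w (X.obj j) (D.obj j))

lemma inl_domComparison_app (X D : J ⥤ Arrow M) (j : J) :
    (PushoutProduct.inl ((toArrow J M).obj X) ((toArrow J M).obj D)).app j ≫
      (domComparison X D).app j = PushoutProduct.inl (X.obj j) (D.obj j) :=
  congrArg (NatTrans.app · j) (PushoutProduct.inl_desc (A := (toArrow J M).obj X)
    (B := (toArrow J M).obj D) _ _ _)

lemma inr_domComparison_app (X D : J ⥤ Arrow M) (j : J) :
    (PushoutProduct.inr ((toArrow J M).obj X) ((toArrow J M).obj D)).app j ≫
      (domComparison X D).app j = PushoutProduct.inr (X.obj j) (D.obj j) :=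
  congrArg (NatTrans.app · j) (PushoutProduct.inr_desc (A := (toArrow J M).obj X)
    (B := (toArrow J M).obj D) _ _ _)

/-- Evaluation preserves pushouts, so the pushout of diagrams and the pointwise pushout product
solve the same problem at each `j`. -/
lemma isPushout_app (X D : J ⥤ Arrow M) (j : J) :
    IsPushout ((X.obj j).hom ▷ (D.obj j).left) ((X.obj j).left ◁ (D.obj j).hom)
      ((PushoutProduct.inl ((toArrow J M).obj X) ((toArrow J M).obj D)).app j)
      ((PushoutProduct.inr ((toArrow J M).obj X) ((toArrow J M).obj D)).app j) :=
  (PushoutProduct.isPushout ((toArrow J M).obj X) ((toArrow J M).obj D)).map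
    ((evaluation J M).obj j)

instance isIso_domComparison (X D : J ⥤ Arrow M) : IsIso (domComparison X D) := by
  rw [NatTrans.isIso_iff_isIso_app]
  intro j
  exact isIso_of_isPushout (isPushout_app X D j) (PushoutProduct.isPushout (X.obj j) (D.obj j)) _
    (inl_domComparison_app X D j) (inr_domComparison_app X D j)

/-- The pointwise pushout product has the tensor product of diagrams as target. -/
def tensorRightIso (X D : J ⥤ Arrow M) :
    (X ⋙ Arrow.rightFunc) ⊗ (D ⋙ Arrow.rightFunc) ≅ (X ⊗ D) ⋙ Arrow.rightFunc :=
  NatIso.ofComponents (fun j ↦ Iso.refl ((X.obj j).right ⊗ (D.obj j).right)) (fun {j j'} t ↦ by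
    refine (Category.comp_id ((X.map t).right ⊗ₘ (D.map t).right)).trans
      (Eq.trans ?_ (Category.id_comp ((X.map t ⊗ₘ D.map t).right)).symm)
    -- On targets, `⊗ₘ` of arrows unfolds to a composite of two whiskerings, whereas the other side
    -- is a single `⊗ₘ` in `M`.
    exact MonoidalCategory.tensorHom_def _ _)

/-- `toArrow` is compatible with tensor products. -/
def tensorIso (X D : J ⥤ Arrow M) :
    PushoutProduct.obj ((toArrow J M).obj X) ((toArrow J M).obj D) ≅ (toArrow J M).obj (X ⊗ D) :=
  Arrow.isoMk (@asIso _ _ _ _ (domComparison X D) (isIso_domComparison X D))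
    (tensorRightIso X D) (by
    refine (PushoutProduct.dom_ext (NatTrans.ext (funext fun j ↦ ?_))
      (NatTrans.ext (funext fun j ↦ ?_)))
    · refine (Category.assoc _ _ _).symm.trans
        ((congrArg (· ≫ _) (inl_domComparison_app X D j)).trans ?_)
      refine (PushoutProduct.inl_corner (X.obj j) (D.obj j)).trans
        (((congrArg (NatTrans.app · j) (PushoutProduct.inl_corner ((toArrow J M).obj X)
          ((toArrow J M).obj D)))).symm.trans ?_)
      exact congrArg (_ ≫ ·) (Category.comp_id
        ((PushoutProduct.corner ((toArrow J M).obj X) ((toArrow J M).obj D)).app j)).symm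
    · refine (Category.assoc _ _ _).symm.trans
        ((congrArg (· ≫ _) (inr_domComparison_app X D j)).trans ?_)
      refine (PushoutProduct.inr_corner (X.obj j) (D.obj j)).trans
        (((congrArg (NatTrans.app · j) (PushoutProduct.inr_corner ((toArrow J M).obj X)
          ((toArrow J M).obj D)))).symm.trans ?_)
      exact congrArg (_ ≫ ·) (Category.comp_id
        ((PushoutProduct.corner ((toArrow J M).obj X) ((toArrow J M).obj D)).app j)).symm)

lemma domComparison_naturality (X : J ⥤ Arrow M) {D E : J ⥤ Arrow M} (φ : D ⟶ E) :
    domComparison X D ≫ Functor.whiskerRight (X ◁ φ) Arrow.leftFunc =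
      PushoutProduct.wL ((toArrow J M).obj X) ((toArrow J M).map φ) ≫ domComparison X E := by
  refine PushoutProduct.dom_ext (NatTrans.ext (funext fun j ↦ ?_))
    (NatTrans.ext (funext fun j ↦ ?_))
  · have h := congrArg (NatTrans.app · j)
      (PushoutProduct.inl_wL ((toArrow J M).obj X) ((toArrow J M).map φ))
    refine (Category.assoc _ _ _).symm.trans
      ((congrArg (· ≫ _) (inl_domComparison_app X D j)).trans ?_)
    refine (PushoutProduct.inl_wL (X.obj j) (φ.app j)).trans ?_
    refine Eq.trans ?_ ((congrArg (· ≫ (domComparison X E).app j) h).symm.trans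
      (Category.assoc _ _ _))
    refine Eq.trans ?_ (Category.assoc _ _ _).symm
    exact congrArg (_ ≫ ·) (inl_domComparison_app X E j).symm
  · have h := congrArg (NatTrans.app · j)
      (PushoutProduct.inr_wL ((toArrow J M).obj X) ((toArrow J M).map φ))
    refine (Category.assoc _ _ _).symm.trans
      ((congrArg (· ≫ _) (inr_domComparison_app X D j)).trans ?_)
    refine (PushoutProduct.inr_wL (X.obj j) (φ.app j)).trans ?_
    refine Eq.trans ?_ ((congrArg (· ≫ (domComparison X E).app j) h).symm.trans
      (Category.assoc _ _ _))
    refine Eq.trans ?_ (Category.assoc _ _ _).symm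
    exact congrArg (_ ≫ ·) (inr_domComparison_app X E j).symm

/-- The isomorphisms `tensorIso` are natural in the second variable, which turns the pointwise `X ◁
φ` into a pushout product of arrows of diagrams. -/
lemma hasLiftingProperty_toArrow_whiskerLeft_iff (X : J ⥤ Arrow M) {D E : J ⥤ Arrow M}
    (φ : D ⟶ E) {Y Z : Arrow (J ⥤ M)} (p : Y ⟶ Z) :
    HasLiftingProperty ((toArrow J M).map (X ◁ φ)) p ↔
      HasLiftingProperty
        (PushoutProduct.whiskerLeft ((toArrow J M).obj X) ((toArrow J M).map φ)) p :=
  (HasLiftingProperty.iff_of_arrow_iso_left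
    (Arrow.isoMk (f := Arrow.mk (PushoutProduct.whiskerLeft ((toArrow J M).obj X)
        ((toArrow J M).map φ))) (g := Arrow.mk ((toArrow J M).map (X ◁ φ)))
      (tensorIso X D) (tensorIso X E) (Arrow.hom_ext _ _ (domComparison_naturality X φ)
      (NatTrans.ext (funext fun j ↦ (Category.id_comp ((X.obj j).right ◁ (φ.app j).right)).trans
        (Category.comp_id _).symm)))) p).symm

end diagrams
end
end EquivariantObject

/-! ### Equivariant lifting from `(♥)` and the main theorem -/

namespace EquivariantObject
noncomputable section

variable {M : Type u} [Category.{v} M] [MonoidalCategory M] [SymmetricCategory M]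
  [MonoidalClosed M] [ModelCategory M]

/-- Under `(♥)`, the pushout product of equivariant maps lifts equivariantly against trivial
fibrations with trivial action. -/
lemma hasLiftingProperty_corner_of_heart (hM : Heart M) {n : ℕ} (hn : 1 ≤ n) {X₀ X₁ : Right n M}
    (f : X₀ ⟶ X₁) (h₀ : IsCofibrant X₀.obj) (h₁ : IsCofibrant X₁.obj)
    (hf : Cofibration (Right.hom f)) {A B : Left n M} (i : A ⟶ B)
    (e : Arrow.mk (Right.toLeftMap f) ≅ Arrow.mk i) {Y₀ Y₁ : Left n M} (g : Y₀ ⟶ Y₁)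
    (hg : Cofibration (Left.hom g)) {Z W : M} (p : Z ⟶ W) (hp : trivialFibrations M p) :
    HasLiftingProperty (PushoutProduct.corner (Arrow.mk i) (Arrow.mk g))
      ((Functor.const (SingleObj (Equiv.Perm (Fin n)))).map p) := by
  have h : HasLiftingProperty (PushoutProduct.corner (Arrow.mk (Right.toLeftMap f)) (Arrow.mk g))
      ((Functor.const (SingleObj (Equiv.Perm (Fin n)))).map p) :=
    -- Coinvariants are left adjoint to the trivial action, so the cofibration given by `(♥)`
    -- becomes an equivariant lifting property.
    (colimConstAdj.hasLiftingProperty_iff _ _).1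
      ((ProjectiveArrow.cofibration_iff_lifting _).1 (hM n hn X₀ X₁ f h₀ h₁ hf Y₀ Y₁ g hg) p hp)
  exact (HasLiftingProperty.iff_of_arrow_iso_left
    (whiskerRightIso e (Arrow.mk g) : (Arrow.mk (Right.toLeftMap f) ⊗ Arrow.mk g : Arrow (Left n M))
      ≅ Arrow.mk i ⊗ Arrow.mk g) _).1 h

/-- Forgetting the action preserves pushouts, so it commutes with corner maps. -/
lemma cofibration_latch_toArrow {n : ℕ} {D E : Left n (Arrow M)} (φ : D ⟶ E)
    (h : Cofibration (Left.hom φ)) :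
    Cofibration (Left.hom (ProjectiveArrow.latch ((toArrow _ M).map φ))) :=
  ProjectiveArrow.cofibration_of_arrow_iso
    (ProjectiveArrow.latchMapIso ((evaluation _ M).obj (SingleObj.star _)) ((toArrow _ M).map φ))
    ((ProjectiveArrow.cofibration_iff_left_latch (Left.hom φ)).1 h).2

/-- Under `(♥)`, the functor `X ⊗_{Σ_n} -` for an underlying cofibrant `X` sends underlying
cofibrations of arrows to cofibrations. -/
theorem cofibration_tensorOver (hM : Heart M) {n : ℕ} (hn : 1 ≤ n) (X : Right n (Arrow M))
    [hX : IsCofibrant X.obj] {D E : Left n (Arrow M)} (φ : D ⟶ E) (hφ : Cofibration (Left.hom φ)) :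
    Cofibration (tensorOver X φ) := by
  rw [ProjectiveArrow.cofibration_iff_lifting]
  intro Z W p hp
  rw [ProjectiveArrow.mem_trivialFibrations_iff] at hp
  -- The problem becomes equivariant, against `p` with trivial action, and then moves to arrows of
  -- `Σ_n`-objects.
  refine (colimConstAdj.hasLiftingProperty_iff _ _).2 (hasLiftingProperty_of_toArrow _ _ ?_)
  rw [hasLiftingProperty_toArrow_whiskerLeft_iff]
  -- Writing `X ⊗ φ` as the pushout product of `∅ ⟶ X` with `φ` makes the criterion with four
  -- components applicable.
  refine (HasLiftingProperty.iff_of_arrow_iso_left (PushoutProduct.initialCornerIso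
    ((toArrow _ M).obj X.toLeft) (Arrow.mk ((toArrow _ M).map φ))) _).1 ?_
  have hX₀ : IsCofibrant X.obj.left := ProjectiveArrow.isCofibrant_left _
  have hX₁ : IsCofibrant X.obj.right := ProjectiveArrow.isCofibrant_right _
  have hφ₀ := ((ProjectiveArrow.cofibration_iff_left_latch (Left.hom φ)).1 hφ).1
  have hφ₁ := cofibration_latch_toArrow φ hφ
  -- A concrete `∅` with right action, so that `∅ ⟶ X₀` is a map to which `(♥)` applies; `e₀`
  -- compares it with the source part of the map from the chosen initial arrow.
  let s : Right n M := (Functor.const _).obj (⊥_ M)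
  let f : s ⟶ X ⋙ Arrow.leftFunc :=
    { app _ := initial.to _
      naturality _ _ _ := initialIsInitial.hom_ext _ _ }
  have hs : IsCofibrant s.obj :=
    haveI : IsIso (initial.to (⊥_ M)) := isIso_of_isInitial initialIsInitial initialIsInitial _
    inferInstanceAs (Cofibration (initial.to (⊥_ M)))
  have hf : Cofibration (Right.hom f) := hX₀
  have hi : IsInitial (Right.toLeft s) := IsInitial.ofUniqueHom
    (fun _ ↦ { app _ := initial.to _, naturality _ _ _ := initialIsInitial.hom_ext _ _ })
    (fun _ _ ↦ NatTrans.ext (funext fun _ ↦ initialIsInitial.hom_ext _ _))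
  let e₀ : Arrow.mk (Right.toLeftMap f) ≅
      Arrow.mk (Arrow.Hom.left (initial.to ((toArrow _ M).obj X.toLeft))) :=
    Arrow.isoMk (hi.uniqueUpToIso (IsInitial.isInitialObj Arrow.leftFunc _ initialIsInitial))
      (Iso.refl _) (hi.hom_ext _ _)
  -- The equivariant map `X₀ ⟶ X₁`, identified by `e₁` with the corner map of `∅ ⟶ X`.
  let f' : X ⋙ Arrow.leftFunc ⟶ X ⋙ Arrow.rightFunc := Functor.whiskerLeft X Arrow.leftToRight
  have hf' : Cofibration (Right.hom f') := ProjectiveArrow.cofibration_hom X.obj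
  let e₁ := (ProjectiveArrow.latchInitialIso ((toArrow _ M).obj X.toLeft)).symm
  exact PushoutProduct.hasLiftingProperty_corner_arrow _ _ _
    (hasLiftingProperty_corner_of_heart hM hn f hs hX₀ hf _ e₀ _ hφ₀ _ hp.1)
    (hasLiftingProperty_corner_of_heart hM hn f hs hX₀ hf _ e₀ _ hφ₁ _ hp.1)
    (hasLiftingProperty_corner_of_heart hM hn f' hX₀ hX₁ hf' _ e₁ _ hφ₀ _ hp.1)
    (hasLiftingProperty_corner_of_heart hM hn f' hX₀ hX₁ hf' _ e₁ _ hφ₁ _ hp.2)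

end
end EquivariantObject

theorem mainTheorem8 {M : Type u} [Category.{v} M] [MonoidalCategory M] [SymmetricCategory M]
    [MonoidalClosed M] [ModelCategory M] [CofibrantlyGenerated M] [PushoutProductAxiom M]
    (hM : Heart M) :
    ClubCof (Arrow M) := by
  intro n hn X hX V W f hf
  -- `n ≥ 1` enters here: iterated pushout products are controlled from one factor on.
  obtain ⟨m, rfl⟩ := Nat.exists_eq_succ_of_ne_zero (Nat.one_le_iff_ne_zero.1 hn)
  exact EquivariantObject.cofibration_tensorOver hM hn X _
    (ProjectiveArrow.cofibration_pow f hf m)
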